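/- **Problem (DCFSR).** A network is a finite undirected multigraph with link set $\mathcal E$. All links have the same power function $f(0)=0$, $f(x)=\sigma+\mu x^{\alpha}$ for $x>0$, with $\sigma,\mu>0$, $\alpha>1$, and the same maximum transmission rate $C>0$. There are $n\ge 1$ flows; flow $i$ has an amount $w_i>0$ of data, release time $r_i$, deadline $d_i>r_i$, source $p_i$ and destination $q_i\ne p_i$. Let $D_i=w_i/(d_i-r_i)$, $D=\max_i D_i$, $T_0=\min_i r_i$, $T_1=\max_i d_i$. A schedule assigns to every flow a path $\mathcal P_i$ from $p_i$ to $q_i$ and to every link the flow that it transmits at each time and the rate. A link transmits at most one flow at a time, and each link of $\mathcal P_i$ transmits the whole amount $w_i$ of flow $i$ during $[r_i,d_i]$ (flow $i$ uses no other link and no other time). If $x_e(t)$ is the rate of link $e$ at time $t$ and $\mathcal E_a$ is the set of links with $x_e(t)>0$ for some $t\in[T_0,T_1]$, the energy of the schedule $\mathcal S$ is $$\Phi_f(\mathcal S)=(T_1-T_0)\,|\mathcal E_a|\,\sigma+\int_{T_0}^{T_1}\sum_{e\in\mathcal E_a}\mu\,x_e(t)^{\alpha}\,dt .$$ The schedule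 is feasible if moreover $x_e(t)\le C$ for all $e,t$. Let $\Phi_{opt}$ be the infimum of $\Phi_f$ over the feasible schedules. **Algorithm Random-Schedule.** Let $t_0<\dots<t_K$ be the distinct release times and deadlines, $I_k=[t_{k-1},t_k]$, and $\lambda=(t_K-t_0)/\min_k|I_k|$. Flow $i$ is active in $I_k$ if $I_k\subseteq[r_i,d_i]$. (1) For every $k$, compute an optimal fractional multi-commodity flow: every active flow $i$ sends a unit fractional flow $y_{i}(k)$ from $p_i$ to $q_i$ (links can be used in both directions), and $\sum_e f\big(\sum_i D_i\,y_{i,e}(k)\big)$ is minimal (no bound on the link loads is imposed). (2) For every $k$ and active $i$, repeatedly extract a path from $p_i$ to $q_i$ in the support of $y_i(k)$, give it the minimum of the remaining $y_i(k)$ on it as weight $w_{\mathcal P}(k)$, and subtract this weight along the path, until $y_i(k)$ is zero. (3) Independently for every flow $i$, choose the path $\mathcal P$ with probability $\sum_k w_{\mathcal P}(k)|I_k|/(d_i-r_i)$. (4) In $I_k$, link $e$ transmits at rate $\sum D_i$, the sum being over the active flows $i$ routed through $e$; it transmits the amount $D_i|I_k|$ of each of these flows, one flow after the other, in the order of earliest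 deadline first. **Theorem.** For all $\sigma,\mu,C>0$ and $\alpha>1$ there is a constant $c>0$, depending only on the parameters $\sigma,\mu,\alpha,C$ of the power function, such that the following holds for every network and every set of $n\ge1$ flows for which a feasible schedule exists. Put $\gamma=c\,\lambda^{\alpha}\,(n^2\,\max\{1,\log D\})^{\alpha-1}$. The algorithm can be carried out (optimal fractional solutions exist and can be completely decomposed into paths), and for every possible choice of the optimal fractional solutions and of the extracted paths: the weights in step (3) are probabilities with sum $1$; every schedule that may be produced meets all deadlines (it is a schedule as defined above; the bound $x_e(t)\le C$ is not guaranteed for it); and the expected energy of the produced schedule is at most $\gamma\,\Phi_{opt}$. Consequently, for every $a>0$ the probability that its energy exceeds $a\gamma\,\Phi_{opt}$ is at most $1/a$. -/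

import Mathlib

open scoped BigOperators

noncomputable section

namespace DCFSR

/-- A network: a finite undirected multigraph.  `E` is the set of links, and `fst e`, `snd e` are the
two ends of the link `e` (in an arbitrary order). -/
structure Network (V E : Type*) where
  fst : E → V
  snd : E → V

/-- A link together with a direction in which it is traversed. -/
abbrev Arc (E : Type*) := E × Bool

section Paths

variable {V E : Type*}

/-- The node at which the arc `a` starts. -/
def Network.tail (G : Network V E) (a : Arc E) : V := if a.2 then G.fst a.1 else G.snd a.1

/-- The node at which the arc `a` ends. -/
def Network.head (G : Network V E) (a : Arc E) : V := if a.2 then G.snd a.1 else G.fst a.1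

/-- `G.IsWalk u l v`: the list of arcs `l` is a walk from `u` to `v`. -/
inductive Network.IsWalk (G : Network V E) : V → List (Arc E) → V → Prop
  | nil (v : V) : G.IsWalk v [] v
  | cons (a : Arc E) (l : List (Arc E)) (v : V) :
      G.IsWalk (G.head a) l v → G.IsWalk (G.tail a) (a :: l) v

/-- `G.IsPath u l v`: the list of arcs `l` is a path from `u` to `v` (no node is repeated). -/
def Network.IsPath (G : Network V E) (u : V) (l : List (Arc E)) (v : V) : Prop :=
  G.IsWalk u l v ∧ (u :: l.map G.head).Nodup

/-- The link `e` lies on the path `l`. -/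
def OnPath (e : E) (l : List (Arc E)) : Prop := ∃ a ∈ l, a.1 = e

end Paths

/-- A set of `n` deadline-constrained flows on the node set `V`. -/
structure Flows (V : Type*) (n : ℕ) where
  /-- amount of data -/
  w : Fin n → ℝ
  /-- release time -/
  r : Fin n → ℝ
  /-- deadline -/
  d : Fin n → ℝ
  /-- source -/
  src : Fin n → V
  /-- destination -/
  dst : Fin n → V
  w_pos : ∀ i, 0 < w i
  r_lt_d : ∀ i, r i < d i
  src_ne_dst : ∀ i, src i ≠ dst i

section Time

variable {V : Type*} {n : ℕ}

/-- The density `D_i = w_i / (d_i - r_i)`. -/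
def Flows.density (J : Flows V n) (i : Fin n) : ℝ := J.w i / (J.d i - J.r i)

/-- `D = max_i D_i`. -/
def Flows.maxDensity (J : Flows V n) : ℝ := ⨆ i, J.density i

/-- `T₀ = min_i r_i`. -/
def Flows.T0 (J : Flows V n) : ℝ := ⨅ i, J.r i

/-- `T₁ = max_i d_i`. -/
def Flows.T1 (J : Flows V n) : ℝ := ⨆ i, J.d i

/-- The set of all release times and deadlines. -/
def Flows.times (J : Flows V n) : Finset ℝ := Finset.univ.image J.r ∪ Finset.univ.image J.d

/-- The number `K` of elementary intervals. -/
def Flows.K (J : Flows V n) : ℕ := J.times.card - 1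

/-- Left end of the `k`-th interval; the release times and deadlines are listed increasingly. -/
def Flows.left (J : Flows V n) (k : Fin J.K) : ℝ :=
  J.times.orderEmbOfFin rfl ⟨k.1, lt_of_lt_of_le k.2 (Nat.sub_le _ _)⟩

/-- Right end of the `k`-th interval. -/
def Flows.right (J : Flows V n) (k : Fin J.K) : ℝ :=
  J.times.orderEmbOfFin rfl ⟨k.1 + 1, Nat.add_lt_of_lt_sub k.2⟩

/-- The length `|I_k|`. -/
def Flows.len (J : Flows V n) (k : Fin J.K) : ℝ := J.right k - J.left k

/-- `λ = (t_K - t_0) / min_k |I_k|`. -/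
def Flows.lam (J : Flows V n) : ℝ := (J.T1 - J.T0) / ⨅ k, J.len k

/-- The interval `I_k` is contained in the span `[r_i, d_i]`. -/
def Flows.Active (J : Flows V n) (i : Fin n) (k : Fin J.K) : Prop :=
  J.r i ≤ J.left k ∧ J.right k ≤ J.d i

end Time

/-- The power function: `0` at rate `0`, and `σ + μ x ^ α` at rate `x > 0`. -/
def power (σ μ α x : ℝ) : ℝ := if x = 0 then 0 else σ + μ * x ^ α

/-! ### Schedules -/

/-- A routing path for every flow, and the rate `rate i e t` at which the link `e` transmits data of
the flow `i` at time `t`. -/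
structure Schedule (E : Type*) (n : ℕ) where
  path : Fin n → List (Arc E)
  rate : Fin n → E → ℝ → ℝ

section Schedules

variable {V E : Type*} {n : ℕ}

/-- The transmission rate `x_e(t)` of the link `e`. -/
def Schedule.linkRate (S : Schedule E n) (e : E) (t : ℝ) : ℝ := ∑ i, S.rate i e t

/-- The schedule routes every flow on a single path, a link transmits at most one flow at a time
(so that `x_e(t)` is the rate of the flow that is being transmitted), and every link on the path of
a flow transmits all data of that flow between its release time and its deadline. -/
structure Schedule.MeetsDeadlines (S : Schedule E n) (G : Network V E) (J : Flows V n) : Prop where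
  isPath : ∀ i, G.IsPath (J.src i) (S.path i) (J.dst i)
  measurable : ∀ i e, Measurable (S.rate i e)
  nonneg : ∀ i e t, 0 ≤ S.rate i e t
  span : ∀ i e t, t ∉ Set.Icc (J.r i) (J.d i) → S.rate i e t = 0
  onPath : ∀ i e t, ¬ OnPath e (S.path i) → S.rate i e t = 0
  exclusive : ∀ e t i j, i ≠ j → S.rate i e t = 0 ∨ S.rate j e t = 0
  complete : ∀ i e, OnPath e (S.path i) → ∫ t in (J.r i)..(J.d i), S.rate i e t = J.w i

/-- A feasible solution of the problem with maximum transmission rate `C`. -/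
def Schedule.Feasible (S : Schedule E n) (G : Network V E) (J : Flows V n) (C : ℝ) : Prop :=
  S.MeetsDeadlines G J ∧ ∀ e t, S.linkRate e t ≤ C

open Classical in
/-- The set `E_a` of active links. -/
def Schedule.activeLinks [Fintype E] (S : Schedule E n) (J : Flows V n) : Finset E :=
  Finset.univ.filter fun e => ∃ t ∈ Set.Icc J.T0 J.T1, 0 < S.linkRate e t

/-- The energy `Φ_f(S)`: an active link is on during the whole period `[T₀, T₁]`. -/
def Schedule.energy [Fintype E] (S : Schedule E n) (J : Flows V n) (σ μ α : ℝ) : ℝ :=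
  (J.T1 - J.T0) * (S.activeLinks J).card * σ
    + ∫ t in J.T0..J.T1, ∑ e ∈ S.activeLinks J, μ * (S.linkRate e t) ^ α

end Schedules

/-! ### The fractional multi-commodity flow problem in one interval -/

section Fractional

variable {V E : Type*} [Fintype E] {n : ℕ}

open Classical in
/-- `y i a` is the proportion of the flow `i` that is sent along the arc `a` during `I_k`:
a unit flow from the source to the destination for every active flow, and zero for the others. -/
structure IsFractional (G : Network V E) (J : Flows V n) (k : Fin J.K)
    (y : Fin n → Arc E → ℝ) : Prop where
  nonneg : ∀ i a, 0 ≤ y i a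
  inactive : ∀ i, ¬ J.Active i k → ∀ a, y i a = 0
  conservation : ∀ i, J.Active i k → ∀ v : V,
    (∑ a, if G.tail a = v then y i a else 0) - (∑ a, if G.head a = v then y i a else 0)
      = (if v = J.src i then 1 else 0) - (if v = J.dst i then 1 else 0)

/-- The load of a link, when every flow `i` has traffic load `D_i`. -/
def fracLoad (J : Flows V n) (y : Fin n → Arc E → ℝ) (e : E) : ℝ :=
  ∑ i, J.density i * (y i (e, true) + y i (e, false))

/-- The total cost on the links. -/
def fracCost (J : Flows V n) (σ μ α : ℝ) (y : Fin n → Arc E → ℝ) : ℝ :=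
  ∑ e, power σ μ α (fracLoad J y e)

/-- An optimal solution of the fractional multi-commodity flow problem in `I_k`. -/
def IsOptimalFractional (G : Network V E) (J : Flows V n) (σ μ α : ℝ) (k : Fin J.K)
    (y : Fin n → Arc E → ℝ) : Prop :=
  IsFractional G J k y ∧ ∀ y', IsFractional G J k y' → fracCost J σ μ α y ≤ fracCost J σ μ α y'

end Fractional

/-! ### The algorithm -/

open Classical in
/-- `Extraction G p q y L`: starting from the unit flow `y`, repeatedly extracting a path from `p` to
`q` on which `y` is positive, giving it the smallest value of `y` on it as its weight, and
subtracting this weight along the path, until `y` is zero, can yield the list `L` of weighted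
paths. -/
inductive Extraction {V E : Type*} (G : Network V E) (p q : V) :
    (Arc E → ℝ) → List (List (Arc E) × ℝ) → Prop
  | done : Extraction G p q (fun _ => 0) []
  | step (y : Arc E → ℝ) (P : List (Arc E)) (ω : ℝ) (L : List (List (Arc E) × ℝ)) :
      G.IsPath p P q → (∀ a ∈ P, 0 < y a) → IsLeast (y '' {a | a ∈ P}) ω →
      Extraction G p q (fun a => if a ∈ P then y a - ω else y a) L →
      Extraction G p q y ((P, ω) :: L)

/-- The data computed in a run of Random-Schedule before the random choice: the fractional solutions
`y k` and the weighted paths extracted from them for each interval `k` and each flow `i`. -/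
structure Run (V E : Type*) {n : ℕ} (J : Flows V n) where
  y : Fin J.K → Fin n → Arc E → ℝ
  paths : Fin J.K → Fin n → List (List (Arc E) × ℝ)

section Algorithm

variable {V E : Type*} {n : ℕ} {J : Flows V n}

/-- The data are those of a possible run of the algorithm. -/
def Run.IsValid [Fintype E] (R : Run V E J) (G : Network V E) (σ μ α : ℝ) : Prop :=
  (∀ k, IsOptimalFractional G J σ μ α k (R.y k)) ∧
  ∀ k i, Extraction G (J.src i) (J.dst i) (R.y k i) (R.paths k i)

open Classical in
/-- The set `Q_i` of candidate paths of the flow `i`. -/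
def Run.candidates (R : Run V E J) (i : Fin n) : Finset (List (Arc E)) :=
  Finset.univ.biUnion fun k => ((R.paths k i).map Prod.fst).toFinset

open Classical in
/-- The weight `w_P(k)` of the path `P` in the interval `I_k`; zero if `P` is not used there. -/
def Run.weight (R : Run V E J) (i : Fin n) (k : Fin J.K) (P : List (Arc E)) : ℝ :=
  (((R.paths k i).filter fun x => x.1 = P).map Prod.snd).sum

/-- The probability `∑ₖ w_P(k) |I_k| / (d_i - r_i)` with which `P` is chosen for the flow `i`. -/
def Run.pathProb (R : Run V E J) (i : Fin n) (P : List (Arc E)) : ℝ :=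
  ∑ k, R.weight i k P * J.len k / (J.d i - J.r i)

/-- The possible outcomes of the random choice of a path for every flow. -/
def Run.outcomes (R : Run V E J) : Finset (Fin n → List (Arc E)) :=
  Fintype.piFinset R.candidates

/-- The probability of an outcome; the paths are chosen independently. -/
def Run.prob (R : Run V E J) (P : Fin n → List (Arc E)) : ℝ := ∏ i, R.pathProb i (P i)

open Classical in
/-- The sum of the densities of the flows that are routed through `e` in the interval `I_k`. -/
def rsRate (J : Flows V n) (P : Fin n → List (Arc E)) (e : E) (k : Fin J.K) : ℝ :=
  ∑ i, if J.Active i k ∧ OnPath e (P i) then J.density i else 0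

/-- Earliest deadline first; ties are broken by the index. -/
def Flows.Before (J : Flows V n) (i j : Fin n) : Prop :=
  J.d i < J.d j ∨ (J.d i = J.d j ∧ i < j)

open Classical in
/-- The time at which the link `e` starts transmitting the flow `i` in the interval `I_k`: it
first transmits the data (`D_j |I_k|` for flow `j`) of the flows with earlier deadlines, at rate
`rsRate J P e k`. -/
def edfStart (J : Flows V n) (P : Fin n → List (Arc E)) (e : E) (k : Fin J.K) (i : Fin n) : ℝ :=
  J.left k + ∑ j, if J.Active j k ∧ OnPath e (P j) ∧ J.Before j i then
    J.density j * J.len k / rsRate J P e k else 0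

open Classical in
/-- The schedule produced by Random-Schedule when the paths `P` have been chosen: in the interval
`I_k` the link `e` transmits at rate `rsRate J P e k`, in the order of earliest deadline first, the
amount `D_i |I_k|` of data of every active flow `i` that is routed through it. -/
def rsSchedule (J : Flows V n) (P : Fin n → List (Arc E)) : Schedule E n where
  path := P
  rate := fun i e t => ∑ k, if J.Active i k ∧ OnPath e (P i) ∧
      t ∈ Set.Ico (edfStart J P e k i)
        (edfStart J P e k i + J.density i * J.len k / rsRate J P e k)
    then rsRate J P e k else 0

/-- The expected energy of the schedule produced by the algorithm. -/
def Run.expectedEnergy [Fintype E] (R : Run V E J) (σ μ α : ℝ) : ℝ :=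
  ∑ P ∈ R.outcomes, R.prob P * (rsSchedule J P).energy J σ μ α

open Classical in
/-- The probability that the energy of the schedule produced by the algorithm exceeds `b`. -/
def Run.probEnergyGt [Fintype E] (R : Run V E J) (σ μ α b : ℝ) : ℝ :=
  ∑ P ∈ R.outcomes.filter (fun P => b < (rsSchedule J P).energy J σ μ α), R.prob P

/-- The quantity `λ ^ α (n² log D) ^ (α - 1)`, with `log D` read as `1` when it is smaller. -/
def Flows.ratio (J : Flows V n) (α : ℝ) : ℝ :=
  J.lam ^ α * ((n : ℝ) ^ 2 * max 1 (Real.log J.maxDensity)) ^ (α - 1)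

end Algorithm

end DCFSR

end

/-! Everything is compared with F = ∑ₖ |I_k| · (optimal fractional cost in I_k). Existence of a run.
The power function is lower semicontinuous and dominates `min σ μ * x`, so a fractional optimum
exists by compactness. It is strictly increasing, so an optimum has no directed cycle in its support
(`IsOptimalFractional.acyclicSupport`); hence path extraction can end only at the zero flow
(`exists_extraction`). Lower bound (`Schedule.Feasible.sum_len_mul_fracCost_le`). Since a link
carries one flow at a time, x_e^α splits into a sum over flows, and by convexity flow i costs at
least D_i^α (d_i - r_i) on each link of its path. Routing along the same paths is a fractional
solution in every I_k, and the power-mean inequality bounds its cost; thus F ≤ 2^α n^(α-1) Φ(S) for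
every feasible S. Upper bound (`Run.IsValid.expectedEnergy_le_sum`). Every active link has positive
fractional load in some I_k, so the static energy is at most (T₁ - T₀) ∑ₖ cost ≤ λF, for every
outcome. For the dynamic energy, the power-mean inequality leaves a sum of terms each depending on
one random path. Its expectation needs only the probability that flow i uses e, which is at most the
time average of the fractional flow. Feasibility forces D_i ≤ C, so D_i^α ≤ C^(α-1) D_i, and the
resulting linear load is bounded by the power function. Multiplying the two bounds gives terms in λ
n^(α-1) and n^(2(α-1)), both at most `J.ratio α`; the logarithm enters only as a factor that is at
least 1. Deadlines are met because the earliest-deadline-first slots of a link are disjoint and fill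
its interval exactly. -/

namespace DCFSR

/-! ### Walks and loop erasure. -/

section Walks

variable {V E : Type*} {G : Network V E}

lemma Network.IsWalk.append {u v w : V} {l l' : List (Arc E)} (h : G.IsWalk u l v)
    (h' : G.IsWalk v l' w) : G.IsWalk u (l ++ l') w := by
  induction h with
  | nil v => exact h'
  | cons a l v _ ih => exact .cons a _ _ (ih h')

lemma Network.IsPath.exists_suffix {u v : V} {l : List (Arc E)} (h : G.IsPath u l v) {x : V}
    (hx : x ∈ u :: l.map G.head) : ∃ l' ⊆ l, G.IsPath x l' v := by
  obtain ⟨hw, hn⟩ := h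
  induction hw with
  | nil v =>
    simp only [List.map_nil, List.mem_singleton] at hx
    subst hx
    exact ⟨[], List.Subset.refl _, .nil _, by simp⟩
  | cons a l v hw ih =>
    rcases List.mem_cons.1 hx with rfl | hx
    · exact ⟨a :: l, List.Subset.refl _, .cons a l v hw, hn⟩
    · obtain ⟨l', hl, hp⟩ := ih hx (List.nodup_cons.1 hn).2
      exact ⟨l', List.subset_cons_of_subset _ hl, hp⟩

/-- Loop erasure from the far end: when a new arc starts at a node already visited, the path is cut
back to its suffix from that node. -/
lemma Network.IsWalk.exists_isPath {u v : V} {l : List (Arc E)} (h : G.IsWalk u l v) :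
    ∃ l' ⊆ l, G.IsPath u l' v := by
  induction h with
  | nil v => exact ⟨[], List.Subset.refl _, .nil _, by simp⟩
  | cons a l v hw ih =>
    obtain ⟨l', hl, hp⟩ := ih
    by_cases ha : G.tail a ∈ G.head a :: l'.map G.head
    · obtain ⟨l'', hl', hp'⟩ := hp.exists_suffix ha
      exact ⟨l'', List.subset_cons_of_subset _ (fun _ h => hl (hl' h)), hp'⟩
    · exact ⟨a :: l', List.cons_subset_cons _ hl, .cons a _ _ hp.1,
        List.nodup_cons.2 ⟨ha, hp.2⟩⟩

lemma Network.IsPath.nodup {u v : V} {l : List (Arc E)} (h : G.IsPath u l v) : l.Nodup :=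
  (List.nodup_cons.1 h.2).2.of_map _

lemma Network.IsWalk.of_cons {u v : V} {a : Arc E} {l : List (Arc E)}
    (h : G.IsWalk u (a :: l) v) : u = G.tail a ∧ G.IsWalk (G.head a) l v := by
  cases h with
  | cons _ _ _ h => exact ⟨rfl, h⟩

lemma Network.IsWalk.exists_cons {u v : V} {l : List (Arc E)} (h : G.IsWalk u l v) (huv : u ≠ v) :
    ∃ a l', l = a :: l' := by
  cases h with
  | nil v => exact absurd rfl huv
  | cons a l v _ => exact ⟨a, l, rfl⟩

end Walks

/-! ### Reachability in the support of a flow; what path extraction preserves. -/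

section Support

open Classical

variable {V E : Type*}

lemma Network.IsPath.count_eq {G : Network V E} {u w : V} {l : List (Arc E)}
    (h : G.IsPath u l w) (a : Arc E) : (l.count a : ℝ) = if a ∈ l then 1 else 0 := by
  rw [h.nodup.count]
  split_ifs <;> simp

/-- Some walk from `u` to `v` uses only arcs on which `y` is positive. -/
def PosWalk (G : Network V E) (y : Arc E → ℝ) (u v : V) : Prop :=
  ∃ l, G.IsWalk u l v ∧ ∀ a ∈ l, 0 < y a

/-- No arc on which `y` is positive lies on a closed walk of such arcs. -/
def AcyclicSupport (G : Network V E) (y : Arc E → ℝ) : Prop :=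
  ∀ a, 0 < y a → ¬ PosWalk G y (G.head a) (G.tail a)

variable {G : Network V E} {y : Arc E → ℝ}

lemma PosWalk.trans {u v w : V} (h : PosWalk G y u v) (h' : PosWalk G y v w) :
    PosWalk G y u w := by
  obtain ⟨l, hl, hp⟩ := h
  obtain ⟨l', hl', hp'⟩ := h'
  refine ⟨l ++ l', hl.append hl', fun a ha => ?_⟩
  rcases List.mem_append.1 ha with h | h
  exacts [hp a h, hp' a h]

lemma PosWalk.refl (u : V) : PosWalk G y u u := ⟨[], .nil u, by simp⟩

lemma PosWalk.of_arc {a : Arc E} (ha : 0 < y a) : PosWalk G y (G.tail a) (G.head a) :=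
  ⟨[a], .cons a [] _ (.nil _), by simpa using ha⟩

/-- No arc of positive flow leaves the set of nodes reachable from `u` through the support, so each
arc contributes a nonpositive amount to the net outflow of that set. -/
lemma cut_term_nonpos (hy : ∀ a, 0 ≤ y a) (u : V) (a : Arc E) :
    (if PosWalk G y u (G.tail a) then y a else 0)
      - (if PosWalk G y u (G.head a) then y a else 0) ≤ 0 := by
  by_cases h : PosWalk G y u (G.tail a)
  · rcases (hy a).eq_or_lt with h0 | h0
    · simp [← h0]
    · simp [h, h.trans (PosWalk.of_arc h0)]
  · simp only [h, if_false, zero_sub]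
    split_ifs <;> simp [hy a]

lemma AcyclicSupport.mono {y' : Arc E → ℝ} (h : AcyclicSupport G y) (hle : ∀ a, y' a ≤ y a) :
    AcyclicSupport G y' := fun a ha ⟨l, hl, hp⟩ =>
  h a (ha.trans_le (hle a)) ⟨l, hl, fun b hb => (hp b hb).trans_le (hle b)⟩

lemma Extraction.forall_mem {p q : V} {L : List (List (Arc E) × ℝ)} (h : Extraction G p q y L) :
    ∀ x ∈ L, G.IsPath p x.1 q ∧ 0 < x.2 := by
  induction h with
  | done => simp
  | step y P ω L hP hpos hω _ ih =>
    intro x hx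
    rcases List.mem_cons.1 hx with rfl | hx
    · obtain ⟨⟨a, ha, rfl⟩, -⟩ := hω
      exact ⟨hP, hpos a ha⟩
    · exact ih x hx

lemma Extraction.sum_eq {p q : V} {L : List (List (Arc E) × ℝ)} (h : Extraction G p q y L)
    (a : Arc E) : (L.map fun x => if a ∈ x.1 then x.2 else 0).sum = y a := by
  induction h with
  | done => simp
  | step y P ω L hP hpos hω _ ih =>
    rw [List.map_cons, List.sum_cons, ih]
    by_cases ha : a ∈ P <;> simp [ha]

end Support

/-! ### Net outflow, cuts, and path decomposition of acyclic flows. -/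

section Excess

open Classical

variable {V E : Type*} [Fintype E]

/-- The net amount that leaves the node `v` in the flow `y`. -/
noncomputable def excess (G : Network V E) (y : Arc E → ℝ) (v : V) : ℝ :=
  (∑ a, if G.tail a = v then y a else 0) - (∑ a, if G.head a = v then y a else 0)

lemma excess_sub_mul (G : Network V E) (y z : Arc E → ℝ) (c : ℝ) (v : V) :
    excess G (fun a => y a - c * z a) v = excess G y v - c * excess G z v := by
  have h : ∀ p : Arc E → Prop, (∑ a, if p a then y a - c * z a else 0)
      = (∑ a, if p a then y a else 0) - c * ∑ a, if p a then z a else 0 := by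
    intro p
    rw [Finset.mul_sum, ← Finset.sum_sub_distrib]
    exact Finset.sum_congr rfl fun a _ => by split_ifs <;> simp
  simp only [excess, h]
  ring

/-- Contributions at inner nodes telescope. Counting arcs with multiplicity covers closed walks that
repeat arcs: they become circulations, which can be subtracted from a flow. -/
lemma Network.IsWalk.excess_count {G : Network V E} {u w : V} {l : List (Arc E)}
    (h : G.IsWalk u l w) (v : V) :
    excess G (fun a => (l.count a : ℝ)) v = (if v = u then 1 else 0) - (if v = w then 1 else 0) := by
  induction h with
  | nil w => simp [excess]
  | cons b l w _ ih =>
    have h : ∀ p : Arc E → Prop, (∑ a, if p a then (((b :: l).count a : ℕ) : ℝ) else 0)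
        = (∑ a, if p a then ((l.count a : ℕ) : ℝ) else 0) + if p b then 1 else 0 := by
      intro p
      have : (if p b then (1 : ℝ) else 0) = ∑ a, if a = b then (if p a then (1 : ℝ) else 0) else 0 := by
        simp
      rw [this, ← Finset.sum_add_distrib]
      refine Finset.sum_congr rfl fun a _ => ?_
      by_cases hab : a = b
      · subst hab
        by_cases hp : p a <;> simp [hp]
      · rw [List.count_cons_of_ne (Ne.symm hab)]
        simp [hab]
    have e : excess G (fun a => (((b :: l).count a : ℕ) : ℝ)) v
        = excess G (fun a => ((l.count a : ℕ) : ℝ)) v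
          + (if G.tail b = v then 1 else 0) - (if G.head b = v then 1 else 0) := by
      simp only [excess, h]
      ring
    rw [e, ih]
    simp only [eq_comm (a := v)]
    ring

lemma Network.IsPath.excess_indicator {G : Network V E} {u w : V} {l : List (Arc E)}
    (h : G.IsPath u l w) (v : V) :
    excess G (fun a => if a ∈ l then 1 else 0) v
      = (if v = u then 1 else 0) - (if v = w then 1 else 0) := by
  rw [← h.1.excess_count v]
  congr 1
  funext a
  exact (h.count_eq a).symm

variable {G : Network V E} {y : Arc E → ℝ}

lemma excess_extract {p q : V} {P : List (Arc E)} (hP : G.IsPath p P q) (ω : ℝ) (v : V) :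
    excess G (fun a => if a ∈ P then y a - ω else y a) v
      = excess G y v - ω * ((if v = p then 1 else 0) - (if v = q then 1 else 0)) := by
  rw [← hP.excess_indicator v, ← excess_sub_mul]
  congr 1
  funext a
  split_ifs <;> simp

lemma Extraction.excess_eq {p q : V} {L : List (List (Arc E) × ℝ)} (h : Extraction G p q y L)
    (v : V) : excess G y v
      = (L.map Prod.snd).sum * ((if v = p then 1 else 0) - (if v = q then 1 else 0)) := by
  induction h with
  | done => simp [excess]
  | step y P ω L hP hpos hω _ ih =>
    rw [excess_extract hP] at ih
    rw [List.map_cons, List.sum_cons, add_mul, ← ih]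
    ring

variable [Fintype V]

/-- Discrete divergence theorem: arcs inside `S` cancel. -/
lemma sum_excess (S : Set V) :
    (∑ v, if v ∈ S then excess G y v else 0)
      = ∑ a, ((if G.tail a ∈ S then y a else 0) - (if G.head a ∈ S then y a else 0)) := by
  have h : ∀ t : Arc E → V, (∑ v, if v ∈ S then (∑ a, if t a = v then y a else 0) else 0)
      = ∑ a, if t a ∈ S then y a else 0 := by
    intro t
    have : ∀ v, (if v ∈ S then (∑ a, if t a = v then y a else 0) else 0)
        = ∑ a, if t a = v then (if v ∈ S then y a else 0) else 0 := by
      intro v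
      by_cases hv : v ∈ S <;> simp [hv]
    simp only [this]
    rw [Finset.sum_comm]
    simp
  rw [Finset.sum_sub_distrib, ← h G.tail, ← h G.head, ← Finset.sum_sub_distrib]
  refine Finset.sum_congr rfl fun v _ => ?_
  unfold excess
  split_ifs <;> simp

/-- If `q` were unreachable, the set reachable from `p` would have net outflow `c > 0`, against
`cut_term_nonpos`. -/
lemma posWalk_of_excess (hy : ∀ a, 0 ≤ y a) {p q : V} {c : ℝ} (hc : 0 < c)
    (h : ∀ v, excess G y v = c * ((if v = p then 1 else 0) - (if v = q then 1 else 0))) :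
    PosWalk G y p q := by
  by_contra hq
  have h1 := sum_excess (G := G) (y := y) {v | PosWalk G y p v}
  have h2 := Finset.sum_nonpos fun a (_ : a ∈ Finset.univ) => cut_term_nonpos (G := G) hy p a
  simp only [Set.mem_ofPred_eq] at h1
  rw [← h1] at h2
  have h3 : ∀ v, (if PosWalk G y p v then excess G y v else 0) = if v = p then c else 0 := by
    intro v
    rw [h v]
    by_cases hv : v = p
    · subst hv
      have : v ≠ q := fun e => hq (e ▸ PosWalk.refl v)
      simp [PosWalk.refl, this]
    · by_cases hv' : v = q
      · subst hv'
        simp [hq, hv]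
      · simp [hv, hv']
  simp only [h3, Finset.sum_ite_eq', Finset.mem_univ, if_true] at h2
  linarith

/-- Otherwise `a` enters the set reachable from its head and nothing leaves that set, so its net
outflow would be negative rather than zero. -/
lemma posWalk_of_circulation (hy : ∀ a, 0 ≤ y a) (h : ∀ v, excess G y v = 0) {a : Arc E}
    (ha : 0 < y a) : PosWalk G y (G.head a) (G.tail a) := by
  by_contra hq
  have h1 := sum_excess (G := G) (y := y) {v | PosWalk G y (G.head a) v}
  simp only [Set.mem_ofPred_eq, h, ite_self, Finset.sum_const_zero] at h1
  have h2 := Finset.sum_lt_sum (fun b (_ : b ∈ Finset.univ) => cut_term_nonpos (G := G) hy (G.head a) b)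
    ⟨a, Finset.mem_univ a, by simp [hq, PosWalk.refl, ha]⟩
  rw [← h1] at h2
  simp at h2

/-- Induction on the size of the support: each extraction empties an arc attaining the minimum. The
value `c` is arbitrary because it drops along the way; acyclicity guarantees that nothing is left
when it reaches 0. -/
lemma exists_extraction {p q : V} (hpq : p ≠ q) (hy : ∀ a, 0 ≤ y a) (hac : AcyclicSupport G y)
    {c : ℝ} (hc : 0 ≤ c)
    (h : ∀ v, excess G y v = c * ((if v = p then 1 else 0) - (if v = q then 1 else 0))) :
    ∃ L, Extraction G p q y L := by
  induction hm : (Finset.univ.filter fun a => 0 < y a).card using Nat.strong_induction_on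
    generalizing y c with
  | _ m ih =>
  rcases hc.eq_or_lt with rfl | hc
  · have : y = fun _ => 0 := by
      funext a
      by_contra ha
      have ha' : 0 < y a := lt_of_le_of_ne (hy a) (Ne.symm ha)
      exact hac a ha' (posWalk_of_circulation hy (by simpa using h) ha')
    exact ⟨[], this ▸ Extraction.done⟩
  · obtain ⟨l, hl, hlp⟩ := posWalk_of_excess hy hc h
    obtain ⟨P, hPl, hP⟩ := hl.exists_isPath
    have hPy : ∀ a ∈ P, 0 < y a := fun a ha => hlp a (hPl ha)
    obtain ⟨b, P', rfl⟩ := hP.1.exists_cons hpq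
    set P := b :: P' with hPdef
    obtain ⟨a₀, ha₀, hmin⟩ := P.toFinset.exists_min_image y ⟨b, by simp [hPdef]⟩
    rw [List.mem_toFinset] at ha₀
    replace hmin : ∀ a ∈ P, y a₀ ≤ y a := fun a ha => hmin a (List.mem_toFinset.2 ha)
    have hle : ∀ a, (if a ∈ P then y a - y a₀ else y a) ≤ y a := by
      intro a
      split_ifs
      · linarith [hy a₀]
      · rfl
    have hy' : ∀ a, 0 ≤ (if a ∈ P then y a - y a₀ else y a) := by
      intro a
      split_ifs with ha
      · linarith [hmin a ha]
      · exact hy a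
    have hex : ∀ v, excess G (fun a => if a ∈ P then y a - y a₀ else y a) v
        = (c - y a₀) * ((if v = p then 1 else 0) - (if v = q then 1 else 0)) := by
      intro v
      rw [excess_extract hP, h v]
      ring
    -- If the extracted weight exceeded `c`, the rest would be a flow of positive value from `q` to
    -- `p`; a walk in its support, combined with `P`, would close a cycle through `b`.
    have hc' : 0 ≤ c - y a₀ := by
      by_contra hneg
      have hw := posWalk_of_excess (G := G) (p := q) (q := p) (c := y a₀ - c) hy' (by linarith)
        (fun v => by rw [hex v]; ring)
      obtain ⟨l, hl, hlp⟩ := hw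
      obtain ⟨rfl, hP'⟩ := hP.1.of_cons
      exact hac b (hPy b (by simp [hPdef]))
        (PosWalk.trans ⟨P', hP', fun a ha => hPy a (by simp [hPdef, ha])⟩
          ⟨l, hl, fun a ha => (hlp a ha).trans_le (hle a)⟩)
    have hlt : (Finset.univ.filter fun a => 0 < (if a ∈ P then y a - y a₀ else y a)).card < m := by
      rw [← hm]
      refine Finset.card_lt_card (Finset.ssubset_iff_of_subset ?_ |>.2 ⟨a₀, ?_, ?_⟩)
      · intro a
        simp only [Finset.mem_filter, Finset.mem_univ, true_and]
        exact fun ha => ha.trans_le (hle a)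
      · simpa using hPy a₀ ha₀
      · simp [ha₀]
    obtain ⟨L, hL⟩ := ih _ hlt hy' (hac.mono hle) hc' hex rfl
    exact ⟨(P, y a₀) :: L, .step y P (y a₀) L hP hPy
      ⟨⟨a₀, ha₀, rfl⟩, by rintro _ ⟨a, ha, rfl⟩; exact hmin a ha⟩ hL⟩

end Excess

/-! ### Analytic properties of the power function. -/

section Power

variable {σ μ α : ℝ}

lemma power_nonneg (hσ : 0 < σ) (hμ : 0 < μ) {x : ℝ} (hx : 0 ≤ x) : 0 ≤ power σ μ α x := by
  unfold power
  split_ifs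
  · rfl
  · positivity

/-- Below rate 1 the static term suffices, above it the dynamic one. This gives coercivity for the
existence of optima, and later bounds a linear load by its cost. -/
lemma min_mul_le_power (hσ : 0 < σ) (hμ : 0 < μ) (hα : 1 < α) {x : ℝ} (hx : 0 ≤ x) :
    min σ μ * x ≤ power σ μ α x := by
  unfold power
  split_ifs with h
  · simp [h]
  · have hxa : 0 ≤ x ^ α := Real.rpow_nonneg hx α
    rcases le_total x 1 with h1 | h1
    · calc min σ μ * x ≤ min σ μ * 1 := by gcongr
        _ ≤ σ + 0 := by simp
        _ ≤ σ + μ * x ^ α := by gcongr; positivity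
    · calc min σ μ * x ≤ μ * x := by gcongr; exact min_le_right _ _
        _ = 0 + μ * x ^ (1 : ℝ) := by simp
        _ ≤ σ + μ * x ^ α := by gcongr

lemma power_lt_power (hσ : 0 < σ) (hμ : 0 < μ) (hα : 1 < α) {x y : ℝ} (hx : 0 ≤ x) (hxy : x < y) :
    power σ μ α x < power σ μ α y := by
  have hy : y ≠ 0 := (hx.trans_lt hxy).ne'
  have h := Real.rpow_lt_rpow hx hxy (by linarith : 0 < α)
  unfold power
  rw [if_neg hy]
  split_ifs
  · have : 0 ≤ y ^ α := Real.rpow_nonneg (hx.trans hxy.le) α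
    positivity
  · gcongr

lemma power_le_power (hσ : 0 < σ) (hμ : 0 < μ) (hα : 1 < α) {x y : ℝ} (hx : 0 ≤ x) (hxy : x ≤ y) :
    power σ μ α x ≤ power σ μ α y := by
  rcases hxy.eq_or_lt with rfl | h
  · rfl
  · exact (power_lt_power hσ hμ hα hx h).le

/-- The jump at 0 is `σ` times the indicator of an open set, and `σ ≥ 0`. -/
lemma lowerSemicontinuous_power (hσ : 0 < σ) (hα : 1 < α) :
    LowerSemicontinuous (power σ μ α) := by
  have h : power σ μ α = fun x => ({0}ᶜ : Set ℝ).indicator (fun _ => σ) x + μ * x ^ α := by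
    funext x
    by_cases hx : x = 0
    · simp [power, hx, (zero_lt_one.trans hα).ne']
    · simp [power, hx]
  rw [h]
  exact (isOpen_compl_singleton.lowerSemicontinuous_indicator hσ.le).add
    ((Real.continuous_rpow_const (by linarith)).const_mul μ).lowerSemicontinuous

end Power

/-! ### Existence and acyclicity of optimal fractional flows; existence of a run. -/

section Optimal

open Classical

variable {V E : Type*} [Fintype E] {n : ℕ} {G : Network V E} {J : Flows V n} {σ μ α : ℝ}

omit [Fintype E] in
lemma Flows.density_pos (J : Flows V n) (i : Fin n) : 0 < J.density i :=
  div_pos (J.w_pos i) (sub_pos.2 (J.r_lt_d i))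

omit [Fintype E] in
lemma fracLoad_nonneg {y : Fin n → Arc E → ℝ} (hy : ∀ i a, 0 ≤ y i a) (e : E) :
    0 ≤ fracLoad J y e :=
  Finset.sum_nonneg fun i _ => mul_nonneg (J.density_pos i).le (add_nonneg (hy i _) (hy i _))

omit [Fintype E] in
lemma density_mul_le_fracLoad {y : Fin n → Arc E → ℝ} (hy : ∀ i a, 0 ≤ y i a) (i : Fin n)
    (a : Arc E) : J.density i * y i a ≤ fracLoad J y a.1 := by
  refine le_trans ?_ (Finset.single_le_sum (f := fun i => J.density i * (y i (a.1, true) + y i (a.1, false)))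
    (fun i _ => mul_nonneg (J.density_pos i).le (add_nonneg (hy i _) (hy i _))) (Finset.mem_univ i))
  refine mul_le_mul_of_nonneg_left ?_ (J.density_pos i).le
  rcases a with ⟨e, _ | _⟩
  · simpa using hy i (e, true)
  · simpa using hy i (e, false)

lemma power_le_fracCost (hσ : 0 < σ) (hμ : 0 < μ) {y : Fin n → Arc E → ℝ}
    (hy : ∀ i a, 0 ≤ y i a) (e : E) : power σ μ α (fracLoad J y e) ≤ fracCost J σ μ α y :=
  Finset.single_le_sum (f := fun e => power σ μ α (fracLoad J y e))
    (fun e _ => power_nonneg hσ hμ (fracLoad_nonneg hy e)) (Finset.mem_univ e)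

lemma lowerSemicontinuous_fracCost (hσ : 0 < σ) (hα : 1 < α) :
    LowerSemicontinuous (fracCost (E := E) J σ μ α) := by
  refine lowerSemicontinuous_sum fun e _ => ?_
  refine (lowerSemicontinuous_power hσ hα).comp (g := fun y => fracLoad J y e) ?_
  unfold fracLoad
  fun_prop

lemma isClosed_isFractional (k : Fin J.K) : IsClosed {y | IsFractional G J k y} := by
  have h : {y | IsFractional G J k y} = (⋂ i, ⋂ a, {y | 0 ≤ y i a}) ∩
      (⋂ i, ⋂ (_ : ¬ J.Active i k), ⋂ a, {y | y i a = 0}) ∩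
      (⋂ i, ⋂ (_ : J.Active i k), ⋂ v, {y | excess G (y i) v
        = (if v = J.src i then 1 else 0) - (if v = J.dst i then 1 else 0)}) := by
    ext y
    simp only [Set.mem_inter_iff, Set.mem_iInter, Set.mem_ofPred_eq]
    exact ⟨fun h => ⟨⟨h.1, h.2⟩, h.3⟩, fun h => ⟨h.1.1, h.1.2, h.2⟩⟩
  rw [h]
  refine IsClosed.inter (IsClosed.inter ?_ ?_) ?_
  · exact isClosed_iInter fun i => isClosed_iInter fun a =>
      isClosed_le continuous_const (by fun_prop)
  · exact isClosed_iInter fun i => isClosed_iInter fun _ => isClosed_iInter fun a =>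
      isClosed_eq (by fun_prop) continuous_const
  · refine isClosed_iInter fun i => isClosed_iInter fun _ => isClosed_iInter fun v =>
      isClosed_eq ?_ continuous_const
    unfold excess
    refine Continuous.sub ?_ ?_ <;>
    · refine continuous_finsetSum _ fun a _ => ?_
      split_ifs <;> fun_prop

/-- Adding circulations may make the set of fractional flows unbounded, so the minimum is taken over
the sublevel set of `y₀`, which is bounded by `min_mul_le_power`. -/
lemma exists_isOptimalFractional (hσ : 0 < σ) (hμ : 0 < μ) (hα : 1 < α) {k : Fin J.K}
    {y₀ : Fin n → Arc E → ℝ} (h₀ : IsFractional G J k y₀) :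
    ∃ y, IsOptimalFractional G J σ μ α k y := by
  set s := {y | IsFractional G J k y} ∩ fracCost J σ μ α ⁻¹' Set.Iic (fracCost J σ μ α y₀)
    with hs
  have hmem : ∀ y, IsFractional G J k y → fracCost J σ μ α y ≤ fracCost J σ μ α y₀ → y ∈ s :=
    fun y hy hc => ⟨hy, Set.mem_preimage.2 (Set.mem_Iic.2 hc)⟩
  have hm : 0 < min σ μ := lt_min hσ hμ
  have hcl : IsClosed s := (isClosed_isFractional k).inter
    ((lowerSemicontinuous_fracCost hσ hα).isClosed_preimage _)
  have hsub : s ⊆ Set.Icc (fun _ _ => 0)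
      (fun i _ => fracCost J σ μ α y₀ / (min σ μ * J.density i)) := by
    rintro y ⟨hy, hc⟩
    refine ⟨hy.nonneg, fun i a => ?_⟩
    rw [le_div_iff₀ (mul_pos hm (J.density_pos i))]
    calc y i a * (min σ μ * J.density i) = min σ μ * (J.density i * y i a) := by ring
      _ ≤ min σ μ * fracLoad J y a.1 := by
          gcongr
          exact density_mul_le_fracLoad hy.nonneg i a
      _ ≤ power σ μ α (fracLoad J y a.1) :=
          min_mul_le_power hσ hμ hα (fracLoad_nonneg hy.nonneg _)
      _ ≤ fracCost J σ μ α y := power_le_fracCost hσ hμ hy.nonneg _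
      _ ≤ _ := hc
  have hcpt : IsCompact s := isCompact_Icc.of_isClosed_subset hcl hsub
  obtain ⟨y, hy, hmin⟩ := LowerSemicontinuousOn.exists_isMinOn (s := s)
    ⟨y₀, hmem y₀ h₀ le_rfl⟩ hcpt
    ((lowerSemicontinuous_fracCost (μ := μ) hσ hα).lowerSemicontinuousOn s)
  refine ⟨y, hy.1, fun y' hy' => ?_⟩
  rcases le_total (fracCost J σ μ α y') (fracCost J σ μ α y₀) with h | h
  · exact isMinOn_iff.1 hmin y' (hmem y' hy' h)
  · exact le_trans hy.2 h

/-- Subtracting a small multiple of a closed walk keeps a unit flow, raises no load and strictly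
lowers one, contradicting optimality. -/
lemma IsOptimalFractional.acyclicSupport (hσ : 0 < σ) (hμ : 0 < μ) (hα : 1 < α) {k : Fin J.K}
    {y : Fin n → Arc E → ℝ} (h : IsOptimalFractional G J σ μ α k y) (i : Fin n) :
    AcyclicSupport G (y i) := by
  rintro a ha ⟨l, hl, hpos⟩
  have hact : J.Active i k := by
    by_contra hna
    exact ha.ne' (h.1.inactive i hna a)
  have hw : G.IsWalk (G.tail a) (a :: l) (G.tail a) := .cons a l _ hl
  have hpos' : ∀ b ∈ a :: l, 0 < y i b := by
    intro b hb
    rcases List.mem_cons.1 hb with rfl | hb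
    exacts [ha, hpos b hb]
  obtain ⟨b₀, hb₀, hmin⟩ := (a :: l).toFinset.exists_min_image (y i) ⟨a, by simp⟩
  have hN : (0 : ℝ) < (a :: l).length := by simp; positivity
  -- An arc occurs at most `length` times in the walk, so dividing the minimum by the length keeps
  -- the flow nonnegative.
  set ε := y i b₀ / (a :: l).length with hε
  have hεpos : 0 < ε := div_pos (hpos' b₀ (List.mem_toFinset.1 hb₀)) hN
  set z : Arc E → ℝ := fun b => ((a :: l).count b : ℝ) with hz
  have hz0 : ∀ b, 0 ≤ z b := fun b => Nat.cast_nonneg _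
  have hza : 0 < z a := by simp [hz]; positivity
  have hzle : ∀ b, ε * z b ≤ y i b := by
    intro b
    by_cases hb : b ∈ a :: l
    · calc ε * z b ≤ ε * (a :: l).length := by
            gcongr
            simp only [hz]
            exact_mod_cast List.count_le_length
        _ = y i b₀ := by rw [hε]; field_simp
        _ ≤ y i b := hmin b (List.mem_toFinset.2 hb)
    · have : z b = 0 := by simp only [hz]; exact_mod_cast List.count_eq_zero_of_not_mem hb
      rw [this, mul_zero]
      exact h.1.nonneg i b
  set y' : Fin n → Arc E → ℝ := fun j b => if j = i then y i b - ε * z b else y j b with hy'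
  have hle : ∀ j b, y' j b ≤ y j b := by
    intro j b
    simp only [hy']
    split_ifs with hj
    · subst hj
      linarith [mul_nonneg hεpos.le (hz0 b)]
    · rfl
  have hlt : y' i a < y i a := by
    simp only [hy', if_true]
    linarith [mul_pos hεpos hza]
  have hfrac : IsFractional G J k y' := by
    refine ⟨fun j b => ?_, fun j hj b => ?_, fun j hj v => ?_⟩
    · simp only [hy']
      split_ifs
      · linarith [hzle b]
      · exact h.1.nonneg j b
    · have : j ≠ i := fun e => hj (e ▸ hact)
      simp only [hy', this, if_false]
      exact h.1.inactive j hj b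
    · by_cases hji : j = i
      · subst hji
        have e : y' j = fun b => y j b - ε * z b := by funext b; simp [hy']
        change excess G (y' j) v = _
        rw [e, excess_sub_mul, hw.excess_count, sub_self, mul_zero, sub_zero]
        exact h.1.conservation j hj v
      · have e : y' j = y j := by funext b; simp [hy', hji]
        rw [e]
        exact h.1.conservation j hj v
  have hload : ∀ e, fracLoad J y' e ≤ fracLoad J y e := fun e =>
    Finset.sum_le_sum fun j _ => mul_le_mul_of_nonneg_left
      (add_le_add (hle j _) (hle j _)) (J.density_pos j).le
  have hload' : fracLoad J y' a.1 < fracLoad J y a.1 := by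
    refine Finset.sum_lt_sum (fun j _ => mul_le_mul_of_nonneg_left
      (add_le_add (hle j _) (hle j _)) (J.density_pos j).le) ⟨i, Finset.mem_univ i, ?_⟩
    refine mul_lt_mul_of_pos_left ?_ (J.density_pos i)
    obtain ⟨e, _ | _⟩ := a
    · exact add_lt_add_of_le_of_lt (hle i _) hlt
    · exact add_lt_add_of_lt_of_le hlt (hle i _)
  refine absurd (h.2 y' hfrac) (not_le.2 ?_)
  exact Finset.sum_lt_sum
    (fun e _ => power_le_power hσ hμ hα (fracLoad_nonneg hfrac.nonneg e) (hload e))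
    ⟨a.1, Finset.mem_univ _, power_lt_power hσ hμ hα (fracLoad_nonneg hfrac.nonneg _) hload'⟩

/-- Every active flow is sent along its path. -/
noncomputable def pathFlow (J : Flows V n) (P : Fin n → List (Arc E)) (k : Fin J.K) (i : Fin n)
    (a : Arc E) : ℝ := if J.Active i k ∧ a ∈ P i then 1 else 0

lemma isFractional_pathFlow {P : Fin n → List (Arc E)}
    (hP : ∀ i, G.IsPath (J.src i) (P i) (J.dst i)) (k : Fin J.K) :
    IsFractional G J k (pathFlow J P k) := by
  refine ⟨fun i a => ?_, fun i hi a => ?_, fun i hi v => ?_⟩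
  · unfold pathFlow
    split_ifs <;> norm_num
  · simp [pathFlow, hi]
  · rw [← (hP i).excess_indicator v]
    simp only [pathFlow, hi, true_and]
    rfl

lemma IsFractional.excess_eq {k : Fin J.K} {y : Fin n → Arc E → ℝ} (h : IsFractional G J k y)
    (i : Fin n) (v : V) : excess G (y i) v = (if J.Active i k then 1 else 0) *
      ((if v = J.src i then 1 else 0) - (if v = J.dst i then 1 else 0)) := by
  by_cases hi : J.Active i k
  · rw [if_pos hi, one_mul]
    exact h.conservation i hi v
  · simp [hi, excess, h.inactive i hi]

lemma exists_isValid [Fintype V] (hσ : 0 < σ) (hμ : 0 < μ) (hα : 1 < α)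
    {P : Fin n → List (Arc E)} (hP : ∀ i, G.IsPath (J.src i) (P i) (J.dst i)) :
    ∃ R : Run V E J, R.IsValid G σ μ α := by
  choose y hy using fun k => exists_isOptimalFractional (α := α) hσ hμ hα
    (isFractional_pathFlow (J := J) hP k)
  have hL : ∀ k i, ∃ L, Extraction G (J.src i) (J.dst i) (y k i) L := fun k i =>
    exists_extraction (J.src_ne_dst i) ((hy k).1.nonneg i)
      ((hy k).acyclicSupport hσ hμ hα i) (c := if J.Active i k then 1 else 0)
      (by split_ifs <;> norm_num) ((hy k).1.excess_eq i)
  choose L hL using hL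
  exact ⟨⟨y, L⟩, hy, hL⟩

end Optimal

/-! ### The elementary intervals and their lengths. -/

section Times

open Classical

variable {V : Type*} {n : ℕ} (J : Flows V n)

lemma Flows.r_mem_times (i : Fin n) : J.r i ∈ J.times := by simp [Flows.times]

lemma Flows.d_mem_times (i : Fin n) : J.d i ∈ J.times := by simp [Flows.times]

lemma Flows.card_times (hn : 0 < n) : J.times.card = J.K + 1 := by
  have : 0 < J.times.card := Finset.card_pos.2 ⟨_, J.r_mem_times ⟨0, hn⟩⟩
  unfold Flows.K
  omega

/-- The `j`-th of the release times and deadlines, in increasing order. -/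
noncomputable def Flows.time (hn : 0 < n) (j : ℕ) : ℝ :=
  J.times.orderEmbOfFin (J.card_times hn) ⟨min j J.K, by omega⟩

variable {J} (hn : 0 < n)

lemma Flows.orderEmbOfFin_eq_time {j : ℕ} (hj : j < J.times.card) :
    J.times.orderEmbOfFin rfl ⟨j, hj⟩ = J.time hn j := by
  have hjK : j ≤ J.K := by
    have := J.card_times hn
    omega
  unfold Flows.time
  simp only [min_eq_left hjK]
  exact Finset.orderEmbOfFin_eq_orderEmbOfFin_iff.2 rfl

lemma Flows.left_eq_time (k : Fin J.K) : J.left k = J.time hn k :=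
  Flows.orderEmbOfFin_eq_time hn _

lemma Flows.right_eq_time (k : Fin J.K) : J.right k = J.time hn (k + 1) :=
  Flows.orderEmbOfFin_eq_time hn _

lemma Flows.time_mono : Monotone (J.time hn) := by
  intro i j hij
  refine (J.times.orderEmbOfFin (J.card_times hn)).monotone ?_
  simp only [Fin.mk_le_mk]
  omega

lemma Flows.time_lt_time {i j : ℕ} (hij : i < j) (hj : j ≤ J.K) : J.time hn i < J.time hn j := by
  refine (J.times.orderEmbOfFin (J.card_times hn)).strictMono ?_
  simp only [Fin.mk_lt_mk]
  omega

lemma Flows.exists_time {t : ℝ} (ht : t ∈ J.times) : ∃ j ≤ J.K, J.time hn j = t := by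
  have h := Finset.range_orderEmbOfFin J.times (J.card_times hn)
  have ht' : t ∈ Set.range (J.times.orderEmbOfFin (J.card_times hn)) := by rw [h]; exact ht
  obtain ⟨⟨j, hj⟩, rfl⟩ := ht'
  refine ⟨j, by omega, ?_⟩
  unfold Flows.time
  congr
  omega

lemma Flows.time_mem_times (j : ℕ) : J.time hn j ∈ J.times :=
  Finset.orderEmbOfFin_mem _ _ _

lemma Flows.T0_le_r (i : Fin n) : J.T0 ≤ J.r i := ciInf_le (Set.finite_range _).bddBelow i

lemma Flows.d_le_T1 (i : Fin n) : J.d i ≤ J.T1 := le_ciSup (Set.finite_range _).bddAbove i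

lemma Flows.mem_Icc_of_mem_times {t : ℝ} (ht : t ∈ J.times) : t ∈ Set.Icc J.T0 J.T1 := by
  simp only [Flows.times, Finset.mem_union, Finset.mem_image, Finset.mem_univ, true_and] at ht
  obtain ⟨i, rfl⟩ | ⟨i, rfl⟩ := ht
  · exact ⟨J.T0_le_r i, (J.r_lt_d i).le.trans (J.d_le_T1 i)⟩
  · exact ⟨(J.T0_le_r i).trans (J.r_lt_d i).le, J.d_le_T1 i⟩

lemma Flows.T0_eq_time : J.T0 = J.time hn 0 := by
  have : Nonempty (Fin n) := ⟨⟨0, hn⟩⟩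
  refine le_antisymm (J.mem_Icc_of_mem_times (J.time_mem_times hn 0)).1 (le_ciInf fun i => ?_)
  obtain ⟨j, -, hj⟩ := J.exists_time hn (J.r_mem_times i)
  rw [← hj]
  exact J.time_mono hn (Nat.zero_le j)

lemma Flows.T1_eq_time : J.T1 = J.time hn J.K := by
  have : Nonempty (Fin n) := ⟨⟨0, hn⟩⟩
  refine le_antisymm (ciSup_le fun i => ?_) (J.mem_Icc_of_mem_times (J.time_mem_times hn _)).2
  obtain ⟨j, hjK, hj⟩ := J.exists_time hn (J.d_mem_times i)
  rw [← hj]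
  exact J.time_mono hn hjK

include hn in
lemma Flows.left_lt_right (k : Fin J.K) : J.left k < J.right k := by
  rw [J.left_eq_time hn, J.right_eq_time hn]
  exact J.time_lt_time hn (Nat.lt_succ_self _) k.2

include hn in
lemma Flows.len_pos (k : Fin J.K) : 0 < J.len k := sub_pos.2 (J.left_lt_right hn k)

include hn in
lemma Flows.right_le_left {k k' : Fin J.K} (h : k < k') : J.right k ≤ J.left k' := by
  rw [J.left_eq_time hn, J.right_eq_time hn]
  exact J.time_mono hn h

include hn in
lemma Flows.sum_len : ∑ k, J.len k = J.T1 - J.T0 := by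
  simp only [Flows.len, J.left_eq_time hn, J.right_eq_time hn]
  rw [← Finset.sum_range (fun k => J.time hn (k + 1) - J.time hn k), Finset.sum_range_sub,
    J.T0_eq_time hn, J.T1_eq_time hn]

include hn in
-- If `r i` and `d i` are the times number `a` and `b`, the active intervals are those with `a ≤ k <
-- b`, and their lengths telescope.
lemma Flows.sum_len_active (i : Fin n) :
    (∑ k, if J.Active i k then J.len k else 0) = J.d i - J.r i := by
  obtain ⟨a, haK, ha⟩ := J.exists_time hn (J.r_mem_times i)
  obtain ⟨b, hbK, hb⟩ := J.exists_time hn (J.d_mem_times i)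
  have hab : a ≤ b := by
    by_contra h
    have := J.time_mono hn (not_le.1 h).le
    linarith [J.r_lt_d i]
  have hact : ∀ k : Fin J.K, J.Active i k ↔ (k : ℕ) ∈ Finset.Ico a b := by
    intro k
    have hk := k.2
    rw [Flows.Active, J.left_eq_time hn, J.right_eq_time hn, ← ha, ← hb, Finset.mem_Ico]
    refine and_congr ⟨fun h => ?_, fun h => J.time_mono hn h⟩ ⟨fun h => ?_, fun h => J.time_mono hn h⟩
    · by_contra hlt
      exact absurd h (not_le.2 (J.time_lt_time hn (not_le.1 hlt) haK))
    · by_contra hlt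
      exact absurd h (not_le.2 (J.time_lt_time hn (by omega) (by omega)))
  simp only [hact, Flows.len, J.left_eq_time hn, J.right_eq_time hn]
  rw [← Finset.sum_range (fun k => if k ∈ Finset.Ico a b then J.time hn (k + 1) - J.time hn k else 0),
    ← Finset.sum_filter, ← ha, ← hb, ← Finset.sum_Ico_sub _ hab]
  congr 1
  ext k
  simp only [Finset.mem_filter, Finset.mem_range, Finset.mem_Ico]
  omega

include hn in
/-- Every time of the period lies in one of the elementary intervals. -/
lemma Flows.exists_mem_Ico {t : ℝ} (h0 : J.T0 ≤ t) (h1 : t < J.T1) :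
    ∃ k, t ∈ Set.Ico (J.left k) (J.right k) := by
  rw [J.T0_eq_time hn] at h0
  rw [J.T1_eq_time hn] at h1
  have hex : ∃ j, t < J.time hn j := ⟨_, h1⟩
  have hj := Nat.find_spec hex
  have hle : Nat.find hex ≤ J.K := Nat.find_min' hex h1
  have hpos : Nat.find hex ≠ 0 := by
    intro h
    rw [h] at hj
    linarith
  have hpred := Nat.find_min hex (Nat.sub_lt (Nat.pos_of_ne_zero hpos) one_pos)
  refine ⟨⟨Nat.find hex - 1, by omega⟩, ?_, ?_⟩
  · rw [J.left_eq_time hn]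
    exact not_lt.1 hpred
  · rw [J.right_eq_time hn]
    simpa [Nat.sub_add_cancel (Nat.pos_of_ne_zero hpos)] using hj

include hn in
lemma Flows.T0_lt_T1 : J.T0 < J.T1 :=
  (J.T0_le_r ⟨0, hn⟩).trans_lt ((J.r_lt_d ⟨0, hn⟩).trans_le (J.d_le_T1 ⟨0, hn⟩))

include hn in
lemma Flows.K_pos : 0 < J.K := by
  by_contra h
  have h0 : J.K = 0 := by omega
  have h1 := J.T0_lt_T1 hn
  rw [J.T0_eq_time hn, J.T1_eq_time hn, h0] at h1
  exact lt_irrefl _ h1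

include hn in
lemma Flows.iInf_len_pos : 0 < ⨅ k, J.len k := by
  have : Nonempty (Fin J.K) := ⟨⟨0, J.K_pos hn⟩⟩
  obtain ⟨k, hk⟩ := exists_eq_ciInf_of_finite (f := J.len)
  rw [← hk]
  exact J.len_pos hn k

lemma Flows.iInf_len_le (k : Fin J.K) : ⨅ k, J.len k ≤ J.len k :=
  ciInf_le (Set.finite_range _).bddBelow k

include hn in
lemma Flows.one_le_lam : 1 ≤ J.lam := by
  rw [Flows.lam, one_le_div (J.iInf_len_pos hn), ← J.sum_len hn]
  exact (J.iInf_len_le ⟨0, J.K_pos hn⟩).trans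
    (Finset.single_le_sum (fun k _ => (J.len_pos hn k).le) (Finset.mem_univ _))

include hn in
lemma Flows.period_le_lam_mul_len (k : Fin J.K) : J.T1 - J.T0 ≤ J.lam * J.len k := by
  have h := J.iInf_len_pos hn
  calc J.T1 - J.T0 = J.lam * ⨅ k, J.len k := by rw [Flows.lam]; field_simp
    _ ≤ J.lam * J.len k := by
        have := J.one_le_lam hn
        gcongr
        exact J.iInf_len_le k

end Times

/-! ### Earliest-deadline-first slots: the produced schedule and its energy. -/

section Edf

open Classical MeasureTheory

variable {V E : Type*} {n : ℕ} {J : Flows V n} {P : Fin n → List (Arc E)} {e : E}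
  {k k' : Fin J.K} {i j : Fin n}

/-- The flow `i` is transmitted by the link `e` in the interval `I_k`. -/
def Uses (J : Flows V n) (P : Fin n → List (Arc E)) (e : E) (k : Fin J.K) (i : Fin n) : Prop :=
  J.Active i k ∧ OnPath e (P i)

/-- The duration of the transmission of the flow `i` by the link `e` in the interval `I_k`. -/
noncomputable def slotLen (J : Flows V n) (P : Fin n → List (Arc E)) (e : E) (k : Fin J.K)
    (i : Fin n) : ℝ := J.density i * J.len k / rsRate J P e k

/-- The time during which the link `e` transmits the flow `i` in the interval `I_k`. -/
def slot (J : Flows V n) (P : Fin n → List (Arc E)) (e : E) (k : Fin J.K) (i : Fin n) : Set ℝ :=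
  Set.Ico (edfStart J P e k i) (edfStart J P e k i + slotLen J P e k i)

lemma rsRate_nonneg : 0 ≤ rsRate J P e k :=
  Finset.sum_nonneg fun i _ => by
    split_ifs
    exacts [(J.density_pos i).le, le_rfl]

lemma Uses.rsRate_pos (h : Uses J P e k i) : 0 < rsRate J P e k := by
  refine (J.density_pos i).trans_le ?_
  unfold rsRate
  have := Finset.single_le_sum
    (f := fun i => if J.Active i k ∧ OnPath e (P i) then J.density i else 0)
    (fun i _ => by
      split_ifs
      exacts [(J.density_pos i).le, le_rfl]) (Finset.mem_univ i)
  simpa only [if_pos (show J.Active i k ∧ OnPath e (P i) from h)] using this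

lemma slotLen_nonneg (hn : 0 < n) : 0 ≤ slotLen J P e k i :=
  div_nonneg (mul_nonneg (J.density_pos i).le (J.len_pos hn k).le) rsRate_nonneg

lemma edfStart_eq : edfStart J P e k i
    = J.left k + ∑ j, if Uses J P e k j ∧ J.Before j i then slotLen J P e k j else 0 := by
  simp only [edfStart, Uses, slotLen, and_assoc]

lemma Flows.Before.irrefl : ¬ J.Before i i := by simp [Flows.Before]

lemma Flows.Before.trans {m : Fin n} (h : J.Before m i) (h' : J.Before i j) : J.Before m j := by
  unfold Flows.Before at *
  rcases h with h | ⟨h, hl⟩ <;> rcases h' with h' | ⟨h', hl'⟩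
  · exact .inl (h.trans h')
  · exact .inl (h' ▸ h)
  · exact .inl (h ▸ h')
  · exact .inr ⟨h.trans h', hl.trans hl'⟩

lemma Flows.Before.total (h : i ≠ j) : J.Before i j ∨ J.Before j i := by
  unfold Flows.Before
  rcases lt_trichotomy (J.d i) (J.d j) with h1 | h1 | h1
  · exact .inl (.inl h1)
  · rcases lt_or_gt_of_ne h with h2 | h2
    · exact .inl (.inr ⟨h1, h2⟩)
    · exact .inr (.inr ⟨h1.symm, h2⟩)
  · exact .inr (.inl h1)

/-- The predicate `q` serves two purposes: taken always true, it keeps slots inside the interval;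
taken as "before `j`", it separates the slots of two flows. -/
lemma Uses.slot_end_le (hn : 0 < n) (hi : Uses J P e k i) (q : Fin n → Prop)
    (hq : ∀ m, J.Before m i → q m) (hqi : q i) :
    edfStart J P e k i + slotLen J P e k i
      ≤ J.left k + ∑ m, if Uses J P e k m ∧ q m then slotLen J P e k m else 0 := by
  rw [edfStart_eq, add_assoc]
  gcongr
  have h1 : slotLen J P e k i = ∑ m, if m = i then slotLen J P e k m else 0 := by simp
  rw [h1]
  rw [← Finset.sum_add_distrib]
  refine Finset.sum_le_sum fun m _ => ?_
  by_cases hm : m = i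
  · subst hm
    simp [Flows.Before.irrefl, hi, hqi]
  · have h0 := slotLen_nonneg (P := P) (e := e) (k := k) (i := m) hn
    by_cases hu : Uses J P e k m <;> by_cases hb : J.Before m i
    · simp [hm, hu, hb, hq m hb]
    · simp only [hm, hu, hb, and_false, if_false, add_zero]
      split_ifs
      exacts [h0, le_rfl]
    · simp [hu, hm]
    · simp [hu, hm]

lemma Uses.slot_subset (hn : 0 < n) (hi : Uses J P e k i) :
    slot J P e k i ⊆ Set.Ico (J.left k) (J.right k) := by
  refine Set.Ico_subset_Ico ?_ ?_
  · rw [edfStart_eq]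
    refine le_add_of_nonneg_right (Finset.sum_nonneg fun m _ => ?_)
    split_ifs
    exacts [slotLen_nonneg hn, le_rfl]
  · refine (hi.slot_end_le hn (fun _ => True) (fun _ _ => trivial) trivial).trans ?_
    refine (congrArg (J.left k + ·) (Finset.sum_congr (g := fun m =>
      (if J.Active m k ∧ OnPath e (P m) then J.density m else 0) * (J.len k / rsRate J P e k))
      rfl fun m _ => ?_)).le.trans ?_
    · simp only [and_true, Uses, slotLen]
      split_ifs <;> ring
    · change J.left k + _ ≤ _
      -- The slot lengths of all flows using the link add up to exactly `J.len k`.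
      rw [← Finset.sum_mul, ← rsRate, mul_div_cancel₀ _ hi.rsRate_pos.ne', Flows.len]
      linarith

lemma Uses.slot_end_le_start (hn : 0 < n) (hi : Uses J P e k i) (hij : J.Before i j) :
    edfStart J P e k i + slotLen J P e k i ≤ edfStart J P e k j := by
  rw [edfStart_eq (i := j)]
  exact hi.slot_end_le hn (fun m => J.Before m j) (fun m hm => hm.trans hij) hij

lemma eq_interval_of_mem (hn : 0 < n) {t : ℝ} (h : t ∈ Set.Ico (J.left k) (J.right k))
    (h' : t ∈ Set.Ico (J.left k') (J.right k')) : k = k' := by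
  rcases lt_trichotomy k k' with hk | hk | hk
  · linarith [h.2, h'.1, J.right_le_left hn hk]
  · exact hk
  · linarith [h.1, h'.2, J.right_le_left hn hk]

lemma Uses.slot_inj (hn : 0 < n) (hi : Uses J P e k i) (hj : Uses J P e k' j) {t : ℝ}
    (ht : t ∈ slot J P e k i) (ht' : t ∈ slot J P e k' j) : i = j ∧ k = k' := by
  obtain rfl := eq_interval_of_mem hn (hi.slot_subset hn ht) (hj.slot_subset hn ht')
  refine ⟨?_, rfl⟩
  by_contra hij
  rcases Flows.Before.total (J := J) hij with h | h
  · linarith [ht.2, ht'.1, hi.slot_end_le_start hn h]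
  · linarith [ht.1, ht'.2, hj.slot_end_le_start hn h]

lemma rsSchedule_rate (t : ℝ) : (rsSchedule J P).rate i e t
    = ∑ k, if Uses J P e k i ∧ t ∈ slot J P e k i then rsRate J P e k else 0 := by
  simp only [rsSchedule, Uses, slot, slotLen, and_assoc]

lemma rsSchedule_rate_of_mem (hn : 0 < n) (hi : Uses J P e k i) {t : ℝ}
    (ht : t ∈ slot J P e k i) : (rsSchedule J P).rate i e t = rsRate J P e k := by
  rw [rsSchedule_rate, Finset.sum_eq_single k]
  · simp [hi, ht]
  · intro k' _ hk'
    rw [if_neg]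
    rintro ⟨hu, ht'⟩
    exact hk' (hu.slot_inj hn hi ht' ht).2
  · simp

lemma exists_uses_of_rate_ne_zero {t : ℝ} (h : (rsSchedule J P).rate i e t ≠ 0) :
    ∃ k, Uses J P e k i ∧ t ∈ slot J P e k i := by
  rw [rsSchedule_rate] at h
  obtain ⟨k, -, hk⟩ := Finset.exists_ne_zero_of_sum_ne_zero h
  refine ⟨k, ?_⟩
  by_contra hc
  exact hk (if_neg hc)

lemma rsSchedule_rate_nonneg (t : ℝ) : 0 ≤ (rsSchedule J P).rate i e t := by
  rw [rsSchedule_rate]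
  refine Finset.sum_nonneg fun k _ => ?_
  split_ifs
  exacts [rsRate_nonneg, le_rfl]

lemma rsSchedule_exclusive (hn : 0 < n) {t : ℝ} (hij : i ≠ j) :
    (rsSchedule J P).rate i e t = 0 ∨ (rsSchedule J P).rate j e t = 0 := by
  by_contra! h
  obtain ⟨k, hu, ht⟩ := exists_uses_of_rate_ne_zero h.1
  obtain ⟨k', hu', ht'⟩ := exists_uses_of_rate_ne_zero h.2
  exact hij (hu.slot_inj hn hu' ht ht').1

lemma integral_ite_Ico {r a b d : ℝ} (c : ℝ) (hra : r ≤ a) (hab : a ≤ b) (hbd : b ≤ d) :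
    ∫ t in r..d, (if t ∈ Set.Ico a b then c else 0) = (b - a) * c := by
  have h : (fun t => if t ∈ Set.Ico a b then c else 0) = (Set.Ico a b).indicator fun _ => c := by
    funext t
    simp [Set.indicator_apply]
  rw [h, intervalIntegral.integral_of_le (hra.trans (hab.trans hbd)), ← integral_Ico_eq_integral_Ioc,
    setIntegral_indicator measurableSet_Ico,
    Set.inter_eq_right.2 (Set.Ico_subset_Ico hra hbd), setIntegral_const,
    Real.volume_real_Ico_of_le hab, smul_eq_mul]

lemma intervalIntegrable_ite_Ico (r d a b c : ℝ) :
    IntervalIntegrable (fun t => if t ∈ Set.Ico a b then c else 0) volume r d := by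
  have h : (fun t => if t ∈ Set.Ico a b then c else 0) = (Set.Ico a b).indicator fun _ => c := by
    funext t
    simp [Set.indicator_apply]
  have hc : IntervalIntegrable (fun _ => c) volume r d := intervalIntegrable_const
  rw [h, intervalIntegrable_iff]
  exact (intervalIntegrable_iff.1 hc).indicator measurableSet_Ico

lemma integral_rsSchedule_rate (hn : 0 < n) (hi : OnPath e (P i)) :
    ∫ t in (J.r i)..(J.d i), (rsSchedule J P).rate i e t = J.w i := by
  have hrd := J.r_lt_d i
  have h1 : ∀ t, (rsSchedule J P).rate i e t = ∑ k, if t ∈ Set.Ico (edfStart J P e k i)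
      (edfStart J P e k i + slotLen J P e k i) then
        (if J.Active i k then rsRate J P e k else 0) else 0 := by
    intro t
    rw [rsSchedule_rate]
    refine Finset.sum_congr rfl fun k _ => ?_
    by_cases ha : J.Active i k <;> simp [Uses, ha, hi, slot]
  simp only [h1]
  rw [intervalIntegral.integral_finsetSum fun k _ => intervalIntegrable_ite_Ico _ _ _ _ _]
  have h2 : ∀ k, (∫ t in (J.r i)..(J.d i), if t ∈ Set.Ico (edfStart J P e k i)
      (edfStart J P e k i + slotLen J P e k i) then
        (if J.Active i k then rsRate J P e k else 0) else 0)
      = J.density i * (if J.Active i k then J.len k else 0) := by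
    intro k
    by_cases ha : J.Active i k
    · have hu : Uses J P e k i := ⟨ha, hi⟩
      have hρ := hu.rsRate_pos
      have hlen : 0 < slotLen J P e k i :=
        div_pos (mul_pos (J.density_pos i) (J.len_pos hn k)) hρ
      have hsub := (Set.Ico_subset_Ico_iff (lt_add_of_pos_right _ hlen)).1 (hu.slot_subset hn)
      rw [integral_ite_Ico _ (ha.1.trans hsub.1) (le_add_of_nonneg_right hlen.le)
        (hsub.2.trans ha.2), if_pos ha, if_pos ha, add_sub_cancel_left, slotLen]
      field_simp
    · simp [ha]
  simp only [h2]
  rw [← Finset.mul_sum, J.sum_len_active hn, Flows.density, div_mul_cancel₀ _ (sub_pos.2 hrd).ne']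

lemma rsSchedule_meetsDeadlines (hn : 0 < n) {G : Network V E}
    (hP : ∀ i, G.IsPath (J.src i) (P i) (J.dst i)) :
    (rsSchedule J P).MeetsDeadlines G J where
  isPath := hP
  measurable i e := by
    have : (rsSchedule J P).rate i e = fun t => ∑ k, if Uses J P e k i ∧ t ∈ slot J P e k i
        then rsRate J P e k else 0 := funext fun t => rsSchedule_rate t
    rw [this]
    refine Finset.measurable_fun_sum _ fun k _ => ?_
    refine Measurable.ite ?_ measurable_const measurable_const
    exact (MeasurableSet.const _).inter measurableSet_Ico
  nonneg i e t := rsSchedule_rate_nonneg t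
  span i e t ht := by
    by_contra h
    obtain ⟨k, hu, hs⟩ := exists_uses_of_rate_ne_zero h
    have := hu.slot_subset hn hs
    exact ht ⟨hu.1.1.trans this.1, this.2.le.trans hu.1.2⟩
  onPath i e t ht := by
    by_contra h
    obtain ⟨k, hu, -⟩ := exists_uses_of_rate_ne_zero h
    exact ht hu.2
  exclusive e t i j hij := rsSchedule_exclusive hn hij
  complete i e hi := integral_rsSchedule_rate hn hi

lemma linkRate_eq_of_ne_zero {S : Schedule E n} {t : ℝ}
    (hex : ∀ i j, i ≠ j → S.rate i e t = 0 ∨ S.rate j e t = 0) (hi : S.rate i e t ≠ 0) :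
    S.linkRate e t = S.rate i e t :=
  Finset.sum_eq_single i (fun j _ hj => (hex j i hj).resolve_right hi) (by simp)

lemma rsSchedule_linkRate_le (hn : 0 < n) {t : ℝ} (ht : t ∈ Set.Ico (J.left k) (J.right k)) :
    (rsSchedule J P).linkRate e t ≤ rsRate J P e k := by
  by_cases h : ∃ i, (rsSchedule J P).rate i e t ≠ 0
  · obtain ⟨i, hi⟩ := h
    rw [linkRate_eq_of_ne_zero (fun _ _ hij => rsSchedule_exclusive hn hij) hi]
    obtain ⟨k', hu, hs⟩ := exists_uses_of_rate_ne_zero hi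
    rw [rsSchedule_rate_of_mem hn hu hs, eq_interval_of_mem hn ht (hu.slot_subset hn hs)]
  · push Not at h
    simpa [Schedule.linkRate, h] using rsRate_nonneg

lemma linkRate_nonneg {S : Schedule E n} (h : ∀ i e t, 0 ≤ S.rate i e t) (e : E) (t : ℝ) :
    0 ≤ S.linkRate e t := Finset.sum_nonneg fun i _ => h i e t

variable [Fintype E]

lemma exists_onPath_of_mem_activeLinks
    (h : e ∈ (rsSchedule J P).activeLinks J) : ∃ i, OnPath e (P i) := by
  simp only [Schedule.activeLinks, Finset.mem_filter, Finset.mem_univ, true_and] at h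
  obtain ⟨t, -, ht⟩ := h
  obtain ⟨i, -, hi⟩ := Finset.exists_ne_zero_of_sum_ne_zero ht.ne'
  obtain ⟨k, hu, -⟩ := exists_uses_of_rate_ne_zero hi
  exact ⟨i, hu.2⟩

lemma energy_rsSchedule_le (hn : 0 < n) {σ μ α : ℝ} (hμ : 0 < μ) (hα : 1 < α) :
    (rsSchedule J P).energy J σ μ α
      ≤ (J.T1 - J.T0) * ((rsSchedule J P).activeLinks J).card * σ
        + μ * ∑ k, J.len k * ∑ e, rsRate J P e k ^ α := by
  unfold Schedule.energy
  gcongr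
  have hT := (J.T0_lt_T1 hn).le
  have hnn : ∀ e t, 0 ≤ (rsSchedule J P).linkRate e t :=
    linkRate_nonneg fun _ _ _ => rsSchedule_rate_nonneg _
  -- Step function dominating the dynamic power on `[T₀, T₁)`; the endpoint `T₁` lies in no
  -- half-open interval, hence the passage to `Ico` integrals below.
  set g : ℝ → ℝ := fun t => ∑ k, if t ∈ Set.Ico (J.left k) (J.right k) then
    μ * ∑ e, rsRate J P e k ^ α else 0 with hg
  have hgint : ∫ t in J.T0..J.T1, g t = μ * ∑ k, J.len k * ∑ e, rsRate J P e k ^ α := by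
    rw [hg, intervalIntegral.integral_finsetSum fun k _ => intervalIntegrable_ite_Ico _ _ _ _ _,
      Finset.mul_sum]
    refine Finset.sum_congr rfl fun k _ => ?_
    have h0 : J.T0 ≤ J.left k :=
      (J.mem_Icc_of_mem_times (Finset.orderEmbOfFin_mem _ _ _)).1
    have h1 : J.right k ≤ J.T1 :=
      (J.mem_Icc_of_mem_times (Finset.orderEmbOfFin_mem _ _ _)).2
    rw [integral_ite_Ico _ h0 (J.left_lt_right hn k).le h1, Flows.len]
    ring
  have hgi : IntervalIntegrable g volume J.T0 J.T1 := by
    have h : g = ∑ k, fun t => if t ∈ Set.Ico (J.left k) (J.right k) then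
        μ * ∑ e, rsRate J P e k ^ α else 0 := by
      funext t
      rw [Finset.sum_apply]
    rw [h]
    exact IntervalIntegrable.sum _ fun k _ => intervalIntegrable_ite_Ico _ _ _ _ _
  rw [← hgint, intervalIntegral.integral_of_le hT, intervalIntegral.integral_of_le hT,
    ← integral_Ico_eq_integral_Ioc, ← integral_Ico_eq_integral_Ioc]
  refine integral_mono_of_nonneg ?_ ?_ ?_
  · exact Filter.Eventually.of_forall fun t => Finset.sum_nonneg fun e _ =>
      mul_nonneg hμ.le (Real.rpow_nonneg (hnn e t) α)
  · exact (intervalIntegrable_iff_integrableOn_Ico_of_le hT).1 hgi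
  · refine (ae_restrict_iff' measurableSet_Ico).2 (Filter.Eventually.of_forall fun t ht => ?_)
    obtain ⟨k, hk⟩ := J.exists_mem_Ico hn ht.1 ht.2
    have hgk : g t = ∑ e, μ * rsRate J P e k ^ α := by
      rw [← Finset.mul_sum]
      refine (Finset.sum_eq_single k (fun k' _ hk' => if_neg fun h => ?_) (by simp)).trans
        (if_pos hk)
      exact hk' (eq_interval_of_mem hn h hk)
    rw [hgk]
    calc _ ≤ ∑ e, μ * (rsSchedule J P).linkRate e t ^ α :=
          Finset.sum_le_sum_of_subset_of_nonneg (Finset.subset_univ _) fun e _ _ =>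
            mul_nonneg hμ.le (Real.rpow_nonneg (hnn e t) α)
      _ ≤ _ := by
          refine Finset.sum_le_sum fun e _ => ?_
          have := rsSchedule_linkRate_le (P := P) (e := e) hn hk
          have := hnn e t
          gcongr

end Edf

/-! ### Lower bound on the energy of every feasible schedule. -/

section LowerBound

open Classical MeasureTheory

variable {V E : Type*} {n : ℕ} {G : Network V E} {J : Flows V n} {S : Schedule E n}
  {C σ μ α : ℝ}

/-- Bernoulli's inequality at `x / D - 1`. Integrated, this tangent line plays the role of Jensen's
inequality. -/
lemma tangent_le_rpow (hα : 1 < α) {x D : ℝ} (hx : 0 ≤ x) (hD : 0 < D) :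
    D ^ α + α * D ^ (α - 1) * (x - D) ≤ x ^ α := by
  have h := one_add_mul_self_le_rpow_one_add (s := x / D - 1) (p := α)
    (by have := div_nonneg hx hD.le; linarith) hα.le
  rw [add_sub_cancel, Real.div_rpow hx hD.le, le_div_iff₀ (Real.rpow_pos_of_pos hD α)] at h
  refine le_trans (le_of_eq ?_) h
  rw [Real.rpow_sub_one hD.ne']
  field_simp

lemma Network.IsPath.exists_onPath {u v : V} {l : List (Arc E)} (h : G.IsPath u l v)
    (huv : u ≠ v) : ∃ e, OnPath e l := by
  obtain ⟨a, l', rfl⟩ := h.1.exists_cons huv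
  exact ⟨a.1, a, by simp, rfl⟩

lemma Schedule.Feasible.rate_le (hS : S.Feasible G J C) (i : Fin n) (e : E) (t : ℝ) :
    S.rate i e t ≤ C :=
  (Finset.single_le_sum (fun i _ => hS.1.nonneg i e t) (Finset.mem_univ i)).trans (hS.2 e t)

lemma intervalIntegrable_of_bounded {f : ℝ → ℝ} {B : ℝ} (hf : Measurable f)
    (h0 : ∀ t, 0 ≤ f t) (hB : ∀ t, f t ≤ B) (a b : ℝ) : IntervalIntegrable f volume a b := by
  refine (intervalIntegrable_const (c := B)).mono_fun hf.aestronglyMeasurable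
    (Filter.Eventually.of_forall fun t => ?_)
  change ‖f t‖ ≤ ‖B‖
  rw [Real.norm_of_nonneg (h0 t)]
  exact (hB t).trans (le_abs_self B)

lemma Schedule.Feasible.intervalIntegrable_rate (hS : S.Feasible G J C) (i : Fin n) (e : E)
    (a b : ℝ) : IntervalIntegrable (S.rate i e) volume a b :=
  intervalIntegrable_of_bounded (hS.1.measurable i e) (hS.1.nonneg i e) (hS.rate_le i e) a b

lemma Schedule.Feasible.intervalIntegrable_rpow (hS : S.Feasible G J C) (hα : 1 < α) (i : Fin n)
    (e : E) (a b : ℝ) : IntervalIntegrable (fun t => S.rate i e t ^ α) volume a b :=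
  intervalIntegrable_of_bounded ((hS.1.measurable i e).pow_const α)
    (fun t => Real.rpow_nonneg (hS.1.nonneg i e t) α)
    (fun t => Real.rpow_le_rpow (hS.1.nonneg i e t) (hS.rate_le i e t) (by linarith)) a b

/-- The density is the average rate on any link of the path. Through this bound `C` enters the
approximation factor. -/
lemma Schedule.Feasible.density_le (hS : S.Feasible G J C) (i : Fin n) : J.density i ≤ C := by
  obtain ⟨e, he⟩ := (hS.1.isPath i).exists_onPath (J.src_ne_dst i)
  rw [Flows.density, div_le_iff₀ (sub_pos.2 (J.r_lt_d i)), ← hS.1.complete i e he]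
  calc _ ≤ ∫ t in (J.r i)..(J.d i), C :=
        intervalIntegral.integral_mono (J.r_lt_d i).le (hS.intervalIntegrable_rate i e _ _)
          intervalIntegrable_const fun t => hS.rate_le i e t
    _ = _ := by
        rw [intervalIntegral.integral_const, smul_eq_mul, mul_comm]

/-- The linear term of the tangent at `D_i` integrates to zero, since `D_i` is the mean rate over
the span. -/
lemma Schedule.Feasible.le_integral_rpow (hS : S.Feasible G J C) (hα : 1 < α) {i : Fin n} {e : E}
    (he : OnPath e (S.path i)) :
    J.density i ^ α * (J.d i - J.r i) ≤ ∫ t in J.T0..J.T1, S.rate i e t ^ α := by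
  have hrd := J.r_lt_d i
  have hD := J.density_pos i
  have hi := hS.intervalIntegrable_rate i e (J.r i) (J.d i)
  have hi' := (hi.sub (intervalIntegrable_const (c := J.density i))).const_mul
    (α * J.density i ^ (α - 1))
  calc J.density i ^ α * (J.d i - J.r i)
      = ∫ t in (J.r i)..(J.d i), (J.density i ^ α
          + α * J.density i ^ (α - 1) * (S.rate i e t - J.density i)) := by
        rw [intervalIntegral.integral_add intervalIntegrable_const hi',
          intervalIntegral.integral_const_mul,
          intervalIntegral.integral_sub hi intervalIntegrable_const, hS.1.complete i e he]
        simp only [intervalIntegral.integral_const, smul_eq_mul]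
        have : (J.d i - J.r i) * J.density i = J.w i :=
          mul_div_cancel₀ _ (sub_pos.2 hrd).ne'
        rw [this]
        ring
    _ ≤ ∫ t in (J.r i)..(J.d i), S.rate i e t ^ α :=
        intervalIntegral.integral_mono hrd.le (intervalIntegrable_const.add hi')
          (hS.intervalIntegrable_rpow hα i e _ _)
          fun t => tangent_le_rpow hα (hS.1.nonneg i e t) hD
    _ ≤ _ := intervalIntegral.integral_mono_interval (J.T0_le_r i) hrd.le (J.d_le_T1 i)
        (Filter.Eventually.of_forall fun t => Real.rpow_nonneg (hS.1.nonneg i e t) α)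
        (hS.intervalIntegrable_rpow hα i e _ _)

lemma Schedule.MeetsDeadlines.linkRate_rpow (hS : S.MeetsDeadlines G J) (hα : 1 < α) (e : E)
    (t : ℝ) : S.linkRate e t ^ α = ∑ i, S.rate i e t ^ α := by
  have hα0 : α ≠ 0 := by linarith
  by_cases h : ∃ i, S.rate i e t ≠ 0
  · obtain ⟨i, hi⟩ := h
    rw [linkRate_eq_of_ne_zero (fun i j hij => hS.exclusive e t i j hij) hi,
      Finset.sum_eq_single i (fun j _ hj => ?_) (by simp)]
    rw [(hS.exclusive e t j i hj).resolve_right hi, Real.zero_rpow hα0]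
  · push Not at h
    simp [Schedule.linkRate, h, Real.zero_rpow hα0]

variable [Fintype E]

/-- The links on the given paths. -/
noncomputable def usedLinks (P : Fin n → List (Arc E)) : Finset E :=
  Finset.univ.filter fun e => ∃ i, OnPath e (P i)

lemma Schedule.MeetsDeadlines.usedLinks_subset (hS : S.MeetsDeadlines G J) :
    usedLinks S.path ⊆ S.activeLinks J := by
  intro e he
  simp only [usedLinks, Schedule.activeLinks, Finset.mem_filter, Finset.mem_univ,
    true_and] at he ⊢
  obtain ⟨i, hi⟩ := he
  by_contra! h
  have h0 : ∀ t, S.rate i e t = 0 := by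
    intro t
    by_cases ht : t ∈ Set.Icc (J.r i) (J.d i)
    · refine le_antisymm (le_trans ?_ (h t ⟨(J.T0_le_r i).trans ht.1, ht.2.trans (J.d_le_T1 i)⟩))
        (hS.nonneg i e t)
      exact Finset.single_le_sum (fun i _ => hS.nonneg i e t) (Finset.mem_univ i)
    · exact hS.span i e t ht
  have := hS.complete i e hi
  simp only [h0, intervalIntegral.integral_zero] at this
  linarith [J.w_pos i]

lemma Schedule.Feasible.le_energy (hS : S.Feasible G J C) (hn : 0 < n) (hσ : 0 < σ) (hμ : 0 < μ)
    (hα : 1 < α) :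
    (J.T1 - J.T0) * (usedLinks S.path).card * σ + μ * ∑ e, ∑ i,
      (if OnPath e (S.path i) then J.density i ^ α * (J.d i - J.r i) else 0)
      ≤ S.energy J σ μ α := by
  have hT := J.T0_lt_T1 hn
  have hT' : 0 ≤ J.T1 - J.T0 := by linarith
  have hsub := hS.1.usedLinks_subset
  unfold Schedule.energy
  gcongr
  have hint : ∀ e, IntervalIntegrable (fun t => μ * ∑ i, S.rate i e t ^ α) volume J.T0 J.T1 := by
    intro e
    have h : (fun t => ∑ i, S.rate i e t ^ α) = ∑ i, fun t => S.rate i e t ^ α := by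
      funext t
      rw [Finset.sum_apply]
    refine IntervalIntegrable.const_mul ?_ μ
    rw [h]
    exact IntervalIntegrable.sum _ fun i _ => hS.intervalIntegrable_rpow hα i e _ _
  simp only [hS.1.linkRate_rpow hα]
  rw [intervalIntegral.integral_finsetSum fun e _ => hint e, Finset.mul_sum]
  have hnn : ∀ i e, 0 ≤ ∫ t in J.T0..J.T1, S.rate i e t ^ α := fun i e =>
    intervalIntegral.integral_nonneg hT.le fun t _ => Real.rpow_nonneg (hS.1.nonneg i e t) α
  have heq : ∀ e, ∫ t in J.T0..J.T1, μ * ∑ i, S.rate i e t ^ α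
      = μ * ∑ i, ∫ t in J.T0..J.T1, S.rate i e t ^ α := by
    intro e
    rw [intervalIntegral.integral_const_mul,
      intervalIntegral.integral_finsetSum fun i _ => hS.intervalIntegrable_rpow hα i e _ _]
  simp only [heq]
  rw [← Finset.sum_subset (Finset.subset_univ (S.activeLinks J))]
  · refine Finset.sum_le_sum fun e _ => mul_le_mul_of_nonneg_left ?_ hμ.le
    refine Finset.sum_le_sum fun i _ => ?_
    split_ifs with he
    · exact hS.le_integral_rpow hα he
    · exact hnn i e
  · intro e _ he
    rw [Finset.sum_eq_zero, mul_zero]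
    intro i _
    refine if_neg fun hi => he (hsub ?_)
    simpa [usedLinks] using ⟨i, hi⟩

omit [Fintype E] in
-- Power-mean inequality. It is applied to the paths of a feasible schedule and to the random paths,
-- giving two factors `n ^ (α - 1)`. Each summand depends on a single path, so expectations later
-- need only marginals.
lemma rsRate_rpow_le (hα : 1 < α) (P : Fin n → List (Arc E)) (e : E) (k : Fin J.K) :
    rsRate J P e k ^ α ≤ (n : ℝ) ^ (α - 1) *
      ∑ i, if J.Active i k ∧ OnPath e (P i) then J.density i ^ α else 0 := by
  have h := Real.rpow_sum_le_const_mul_sum_rpow Finset.univ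
    (fun i => if J.Active i k ∧ OnPath e (P i) then J.density i else 0) hα.le
  rw [Finset.card_univ, Fintype.card_fin] at h
  have hα0 : α ≠ 0 := by linarith
  have h1 : ∀ i, |if J.Active i k ∧ OnPath e (P i) then J.density i else 0|
      = if J.Active i k ∧ OnPath e (P i) then J.density i else 0 := fun i =>
    abs_of_nonneg (by
      split_ifs
      exacts [(J.density_pos i).le, le_rfl])
  have h2 : ∀ i, (if J.Active i k ∧ OnPath e (P i) then J.density i else 0) ^ α
      = if J.Active i k ∧ OnPath e (P i) then J.density i ^ α else 0 := by
    intro i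
    split_ifs
    · rfl
    · exact Real.zero_rpow hα0
  simp only [h1, h2] at h
  exact h

omit [Fintype E] in
-- The 2 allows for both arcs of a link; it is the origin of `2 ^ α` in the constant.
lemma fracLoad_pathFlow_le (P : Fin n → List (Arc E)) (e : E) (k : Fin J.K) :
    fracLoad J (pathFlow J P k) e ≤ 2 * rsRate J P e k := by
  unfold fracLoad rsRate
  rw [Finset.mul_sum]
  refine Finset.sum_le_sum fun i _ => ?_
  have hD := (J.density_pos i).le
  unfold pathFlow
  by_cases ha : J.Active i k
  · by_cases he : OnPath e (P i)
    · simp only [ha, he, true_and, if_true]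
      split_ifs <;> linarith
    · have h : ∀ b, (e, b) ∉ P i := fun b hb => he ⟨_, hb, rfl⟩
      simp [h, he]
  · simp [ha]

lemma fracCost_pathFlow_le (hσ : 0 < σ) (hμ : 0 < μ) (hα : 1 < α) (P : Fin n → List (Arc E))
    (k : Fin J.K) : fracCost J σ μ α (pathFlow J P k)
      ≤ (usedLinks P).card * σ + μ * ∑ e, (2 * rsRate J P e k) ^ α := by
  have h : ((usedLinks P).card : ℝ) * σ = ∑ e, if e ∈ usedLinks P then σ else 0 := by
    simp
  rw [h, Finset.mul_sum, ← Finset.sum_add_distrib]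
  refine Finset.sum_le_sum fun e _ => ?_
  have h0 := fracLoad_nonneg (J := J) (y := pathFlow J P k)
    (fun i a => by unfold pathFlow; split_ifs <;> norm_num) e
  have hr : 0 ≤ (2 * rsRate J P e k) ^ α :=
    Real.rpow_nonneg (mul_nonneg zero_le_two rsRate_nonneg) α
  unfold power
  split_ifs with hz he he
  · positivity
  · positivity
  · gcongr
    exact fracLoad_pathFlow_le P e k
  · refine absurd (Finset.sum_eq_zero fun i _ => ?_) hz
    have h : ∀ b, (e, b) ∉ P i := fun b hb => he (by
      simpa [usedLinks] using ⟨i, (e, b), hb, rfl⟩)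
    simp [pathFlow, h]

lemma Schedule.Feasible.sum_len_mul_fracCost_le (hS : S.Feasible G J C) (hn : 0 < n) (hσ : 0 < σ)
    (hμ : 0 < μ) (hα : 1 < α) {y : Fin J.K → Fin n → Arc E → ℝ}
    (hy : ∀ k, IsOptimalFractional G J σ μ α k (y k)) :
    ∑ k, J.len k * fracCost J σ μ α (y k) ≤ 2 ^ α * (n : ℝ) ^ (α - 1) * S.energy J σ μ α := by
  have hn1 : (1 : ℝ) ≤ n := by exact_mod_cast hn
  have h2 : (1 : ℝ) ≤ 2 ^ α := Real.one_le_rpow (by norm_num) (by linarith)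
  have hnα : (1 : ℝ) ≤ (n : ℝ) ^ (α - 1) := Real.one_le_rpow hn1 (by linarith)
  have hB : (1 : ℝ) ≤ 2 ^ α * (n : ℝ) ^ (α - 1) := one_le_mul_of_one_le_of_one_le h2 hnα
  have hT : 0 ≤ J.T1 - J.T0 := by linarith [J.T0_lt_T1 hn]
  set B : ℝ := 2 ^ α * (n : ℝ) ^ (α - 1) with hBdef
  set P := S.path
  have hk : ∀ k, fracCost J σ μ α (y k) ≤ (usedLinks P).card * σ + μ * ∑ e, B *
      ∑ i, if J.Active i k ∧ OnPath e (P i) then J.density i ^ α else 0 := by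
    intro k
    -- The paths of `S`, used in every interval at full density, compete with the fractional
    -- optimum.
    refine ((hy k).2 _ (isFractional_pathFlow hS.1.isPath k)).trans
      ((fracCost_pathFlow_le hσ hμ hα P k).trans ?_)
    gcongr with e
    rw [Real.mul_rpow zero_le_two rsRate_nonneg, hBdef, mul_assoc]
    gcongr
    exact rsRate_rpow_le hα P e k
  calc ∑ k, J.len k * fracCost J σ μ α (y k)
      ≤ ∑ k, J.len k * ((usedLinks P).card * σ + μ * ∑ e, B *
          ∑ i, if J.Active i k ∧ OnPath e (P i) then J.density i ^ α else 0) :=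
        Finset.sum_le_sum fun k _ => mul_le_mul_of_nonneg_left (hk k) (J.len_pos hn k).le
    _ = (J.T1 - J.T0) * (usedLinks P).card * σ + B * (μ * ∑ e, ∑ i,
          if OnPath e (P i) then J.density i ^ α * (J.d i - J.r i) else 0) := by
        simp only [mul_add, Finset.sum_add_distrib]
        rw [← Finset.sum_mul, J.sum_len hn, ← mul_assoc]
        congr 1
        simp only [Finset.mul_sum]
        rw [Finset.sum_comm]
        refine Finset.sum_congr rfl fun e _ => ?_
        rw [Finset.sum_comm]
        refine Finset.sum_congr rfl fun i _ => ?_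
        rw [← J.sum_len_active hn i]
        by_cases he : OnPath e (P i)
        · simp only [he, and_true, if_true, Finset.mul_sum]
          refine Finset.sum_congr rfl fun k _ => ?_
          split_ifs <;> ring
        · simp [he]
    _ ≤ B * ((J.T1 - J.T0) * (usedLinks P).card * σ) + B * (μ * ∑ e, ∑ i,
          if OnPath e (P i) then J.density i ^ α * (J.d i - J.r i) else 0) := by
        refine add_le_add_left (le_mul_of_one_le_left ?_ hB) _
        positivity
    _ ≤ B * S.energy J σ μ α := by
        rw [← mul_add]
        gcongr
        exact hS.le_energy hn hσ hμ hα

lemma Schedule.Feasible.energy_pos (hS : S.Feasible G J C) (hn : 0 < n) (hσ : 0 < σ) (hμ : 0 < μ)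
    (hα : 1 < α) : 0 < S.energy J σ μ α := by
  refine lt_of_lt_of_le ?_ (hS.le_energy hn hσ hμ hα)
  obtain ⟨e, he⟩ := (hS.1.isPath ⟨0, hn⟩).exists_onPath (J.src_ne_dst _)
  have hc : 0 < (usedLinks S.path).card :=
    Finset.card_pos.2 ⟨e, by simpa [usedLinks] using ⟨_, he⟩⟩
  have hT : 0 < J.T1 - J.T0 := by linarith [J.T0_lt_T1 hn]
  refine add_pos_of_pos_of_nonneg (by positivity) (mul_nonneg hμ.le ?_)
  refine Finset.sum_nonneg fun e _ => Finset.sum_nonneg fun i _ => ?_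
  have := J.density_pos i
  have := sub_pos.2 (J.r_lt_d i)
  split_ifs <;> positivity

end LowerBound

/-! ### Path probabilities, marginals, and the static cost. -/

section Expectation

open Classical

variable {V E : Type*} {n : ℕ} {G : Network V E} {J : Flows V n} {R : Run V E J}
  {σ μ α : ℝ}

lemma Extraction.pos_of_mem {p q : V} {y : Arc E → ℝ} {L : List (List (Arc E) × ℝ)}
    (h : Extraction G p q y L) : ∀ x ∈ L, ∀ a ∈ x.1, 0 < y a := by
  induction h with
  | done => simp
  | step y P ω L hP hpos hω _ ih =>
    intro x hx a ha
    rcases List.mem_cons.1 hx with rfl | hx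
    · exact hpos a ha
    · have h := ih x hx a ha
      obtain ⟨⟨b, hb, rfl⟩, -⟩ := hω
      have := hpos b hb
      dsimp only at h
      split_ifs at h <;> linarith

lemma Run.mem_candidates {i : Fin n} {P : List (Arc E)} :
    P ∈ R.candidates i ↔ ∃ k, ∃ x ∈ R.paths k i, x.1 = P := by
  simp only [Run.candidates, Finset.mem_biUnion, Finset.mem_univ, true_and, List.mem_toFinset,
    List.mem_map]

lemma sum_filter_mul (s : Finset (List (Arc E))) (g : List (Arc E) → ℝ)
    (L : List (List (Arc E) × ℝ)) (h : ∀ x ∈ L, x.1 ∈ s) :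
    ∑ P ∈ s, ((L.filter fun x => x.1 = P).map Prod.snd).sum * g P
      = (L.map fun x => x.2 * g x.1).sum := by
  induction L with
  | nil => simp
  | cons x L ih =>
    rw [List.map_cons, List.sum_cons, ← ih fun y hy => h y (List.mem_cons_of_mem _ hy)]
    have h1 : x.2 * g x.1 = ∑ P ∈ s, if x.1 = P then x.2 * g P else 0 := by
      rw [Finset.sum_ite_eq, if_pos (h x List.mem_cons_self)]
    rw [h1, ← Finset.sum_add_distrib]
    refine Finset.sum_congr rfl fun P _ => ?_
    by_cases hP : x.1 = P <;> simp [hP, add_mul]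

lemma Run.sum_weight_mul (i : Fin n) (k : Fin J.K) (g : List (Arc E) → ℝ) :
    ∑ P ∈ R.candidates i, R.weight i k P * g P
      = ((R.paths k i).map fun x => x.2 * g x.1).sum :=
  sum_filter_mul _ g _ fun x hx => Run.mem_candidates.2 ⟨k, x, hx, rfl⟩

lemma Run.sum_pathProb_mul (i : Fin n) (g : List (Arc E) → ℝ) :
    ∑ P ∈ R.candidates i, R.pathProb i P * g P
      = ∑ k, ((R.paths k i).map fun x => x.2 * g x.1).sum * (J.len k / (J.d i - J.r i)) := by
  simp only [← Run.sum_weight_mul, Run.pathProb, Finset.sum_mul]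
  rw [Finset.sum_comm]
  exact Finset.sum_congr rfl fun k _ => Finset.sum_congr rfl fun P _ => by ring

variable [Fintype E]

lemma Run.IsValid.isPath (hR : R.IsValid G σ μ α) {i : Fin n} {P : List (Arc E)}
    (hP : P ∈ R.candidates i) : G.IsPath (J.src i) P (J.dst i) := by
  obtain ⟨k, x, hx, rfl⟩ := Run.mem_candidates.1 hP
  exact ((hR.2 k i).forall_mem x hx).1

lemma Run.IsValid.pathProb_nonneg (hR : R.IsValid G σ μ α) (hn : 0 < n) (i : Fin n)
    (P : List (Arc E)) : 0 ≤ R.pathProb i P := by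
  refine Finset.sum_nonneg fun k _ => div_nonneg (mul_nonneg ?_ (J.len_pos hn k).le)
    (sub_pos.2 (J.r_lt_d i)).le
  refine List.sum_nonneg fun ω hω => ?_
  obtain ⟨x, hx, rfl⟩ := List.mem_map.1 hω
  exact ((hR.2 k i).forall_mem x (List.mem_of_mem_filter hx)).2.le

/-- Both sides are the net outflow of `R.y k i` at the source. -/
lemma Run.IsValid.sum_weights (hR : R.IsValid G σ μ α) (i : Fin n) (k : Fin J.K) :
    ((R.paths k i).map Prod.snd).sum = if J.Active i k then 1 else 0 := by
  have h1 := (hR.1 k).1.excess_eq i (J.src i)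
  have h2 := (hR.2 k i).excess_eq (J.src i)
  rw [h1] at h2
  simpa [J.src_ne_dst i] using h2.symm

lemma Run.IsValid.sum_pathProb (hR : R.IsValid G σ μ α) (hn : 0 < n) (i : Fin n) :
    ∑ P ∈ R.candidates i, R.pathProb i P = 1 := by
  have h := Run.sum_pathProb_mul (R := R) i fun _ => 1
  simp only [mul_one] at h
  rw [h]
  have h1 : ∀ k, ((R.paths k i).map fun x => x.2).sum * (J.len k / (J.d i - J.r i))
      = (if J.Active i k then J.len k else 0) / (J.d i - J.r i) := by
    intro k
    rw [show ((R.paths k i).map fun x => x.2).sum = _ from hR.sum_weights i k]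
    split_ifs <;> simp
  simp only [h1]
  rw [← Finset.sum_div, J.sum_len_active hn, div_self (sub_pos.2 (J.r_lt_d i)).ne']

/-- The probability that the flow `i` is routed through `e` is at most the average proportion of
the flow that the fractional solutions send along `e`. -/
lemma Run.IsValid.sum_pathProb_onPath_le (hR : R.IsValid G σ μ α) (hn : 0 < n) (i : Fin n)
    (e : E) : ∑ P ∈ R.candidates i, R.pathProb i P * (if OnPath e P then 1 else 0)
      ≤ ∑ k, (R.y k i (e, true) + R.y k i (e, false)) * (J.len k / (J.d i - J.r i)) := by
  rw [Run.sum_pathProb_mul]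
  refine Finset.sum_le_sum fun k _ => mul_le_mul_of_nonneg_right ?_
    (div_nonneg (J.len_pos hn k).le (sub_pos.2 (J.r_lt_d i)).le)
  -- The flow on each arc is the total weight of the extracted paths through it, and a path on `e`
  -- contains at least one of its two arcs.
  rw [← (hR.2 k i).sum_eq, ← (hR.2 k i).sum_eq, ← List.sum_map_add]
  refine List.sum_le_sum fun x hx => ?_
  have hω := ((hR.2 k i).forall_mem x hx).2.le
  by_cases he : OnPath e x.1
  · obtain ⟨⟨e', b⟩, ha, rfl⟩ := he
    have he : OnPath e' x.1 := ⟨_, ha, rfl⟩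
    cases b
    · simp only [he, ha, if_true, mul_one]
      split_ifs <;> linarith
    · simp only [he, ha, if_true, mul_one]
      split_ifs <;> linarith
  · simp only [he, if_false, mul_zero]
    split_ifs <;> linarith

lemma Run.IsValid.exists_fracLoad_pos (hR : R.IsValid G σ μ α) {i : Fin n} {P : List (Arc E)}
    (hP : P ∈ R.candidates i) {e : E} (he : OnPath e P) : ∃ k, 0 < fracLoad J (R.y k) e := by
  obtain ⟨k, x, hx, rfl⟩ := Run.mem_candidates.1 hP
  obtain ⟨a, ha, rfl⟩ := he
  refine ⟨k, (mul_pos (J.density_pos i) ((hR.2 k i).pos_of_mem x hx a ha)).trans_le ?_⟩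
  exact density_mul_le_fracLoad (hR.1 k).1.nonneg i a

lemma Run.IsValid.prob_nonneg (hR : R.IsValid G σ μ α) (hn : 0 < n) (P : Fin n → List (Arc E)) :
    0 ≤ R.prob P := Finset.prod_nonneg fun i _ => hR.pathProb_nonneg hn i (P i)

lemma Run.IsValid.sum_prob (hR : R.IsValid G σ μ α) (hn : 0 < n) :
    ∑ P ∈ R.outcomes, R.prob P = 1 := by
  have h := Finset.prod_univ_sum R.candidates fun i P => R.pathProb i P
  simp only [hR.sum_pathProb hn, Finset.prod_const_one] at h
  exact h.symm

lemma Run.IsValid.sum_prob_mul (hR : R.IsValid G σ μ α) (hn : 0 < n) (i : Fin n)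
    (g : List (Arc E) → ℝ) : ∑ P ∈ R.outcomes, R.prob P * g (P i)
      = ∑ P ∈ R.candidates i, R.pathProb i P * g P := by
  -- Expanding a product whose factors other than `i` are total probabilities, equal to 1, gives the
  -- marginal of flow `i`.
  have h := Finset.prod_univ_sum R.candidates
    fun j P => R.pathProb j P * if j = i then g P else 1
  have h1 : ∀ j, ∑ P ∈ R.candidates j, R.pathProb j P * (if j = i then g P else 1)
      = if j = i then ∑ P ∈ R.candidates i, R.pathProb i P * g P else 1 := by
    intro j
    by_cases hj : j = i
    · subst hj
      simp
    · simp [hj, hR.sum_pathProb hn]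
  simp only [h1, Finset.prod_mul_distrib, Finset.prod_ite_eq', Finset.mem_univ, if_true] at h
  exact h.symm

/-- Each active link already pays `σ` in the fractional cost of some interval. That interval may be
short, and weighting the costs by length afterwards is what brings in `λ`. -/
lemma Run.IsValid.mul_card_activeLinks_le (hR : R.IsValid G σ μ α) (hσ : 0 < σ) (hμ : 0 < μ)
    {P : Fin n → List (Arc E)} (hP : P ∈ R.outcomes) :
    ((rsSchedule J P).activeLinks J).card * σ ≤ ∑ k, fracCost J σ μ α (R.y k) := by
  have hnn : ∀ k e, 0 ≤ power σ μ α (fracLoad J (R.y k) e) := fun k e =>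
    power_nonneg hσ hμ (fracLoad_nonneg (hR.1 k).1.nonneg e)
  unfold fracCost
  rw [Finset.sum_comm, ← nsmul_eq_mul, ← Finset.sum_const]
  refine (Finset.sum_le_sum fun e he => ?_).trans (Finset.sum_le_sum_of_subset_of_nonneg
    (Finset.subset_univ _) fun e _ _ => Finset.sum_nonneg fun k _ => hnn k e)
  obtain ⟨i, hi⟩ := exists_onPath_of_mem_activeLinks he
  obtain ⟨k, hk⟩ := hR.exists_fracLoad_pos (Fintype.mem_piFinset.1 hP i) hi
  refine le_trans ?_ (Finset.single_le_sum (fun k _ => hnn k e) (Finset.mem_univ k))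
  rw [power, if_neg hk.ne']
  have := Real.rpow_nonneg hk.le α
  exact le_add_of_nonneg_right (by positivity)

end Expectation

/-! ### Expected energy, the approximation factor, and Markov's inequality. -/

section UpperBound

open Classical

variable {V E : Type*} [Fintype E] {n : ℕ} {G : Network V E} {J : Flows V n} {R : Run V E J}
  {C σ μ α : ℝ}

lemma Run.IsValid.expected_rsRate_rpow_le (hR : R.IsValid G σ μ α) (hn : 0 < n) (hα : 1 < α)
    (e : E) (k : Fin J.K) : ∑ P ∈ R.outcomes, R.prob P * rsRate J P e k ^ α
      ≤ (n : ℝ) ^ (α - 1) * ∑ i, (if J.Active i k then 1 else 0) * (J.density i ^ α *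
        ∑ k', (R.y k' i (e, true) + R.y k' i (e, false)) * (J.len k' / (J.d i - J.r i))) := by
  calc ∑ P ∈ R.outcomes, R.prob P * rsRate J P e k ^ α
      ≤ ∑ P ∈ R.outcomes, R.prob P * ((n : ℝ) ^ (α - 1) * ∑ i, (if J.Active i k then 1 else 0) *
          (J.density i ^ α * if OnPath e (P i) then 1 else 0)) := by
        refine Finset.sum_le_sum fun P _ =>
          mul_le_mul_of_nonneg_left ?_ (hR.prob_nonneg hn P)
        refine (rsRate_rpow_le hα P e k).trans (le_of_eq ?_)
        congr 1
        refine Finset.sum_congr rfl fun i _ => ?_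
        by_cases ha : J.Active i k <;> simp [ha]
    _ = (n : ℝ) ^ (α - 1) * ∑ i, (if J.Active i k then 1 else 0) * (J.density i ^ α *
          ∑ P ∈ R.outcomes, R.prob P * if OnPath e (P i) then 1 else 0) := by
        simp only [Finset.mul_sum]
        rw [Finset.sum_comm]
        exact Finset.sum_congr rfl fun i _ => Finset.sum_congr rfl fun P _ => by ring
    _ ≤ _ := by
        refine mul_le_mul_of_nonneg_left (Finset.sum_le_sum fun i _ => ?_) (by positivity)
        refine mul_le_mul_of_nonneg_left (mul_le_mul_of_nonneg_left ?_
          (Real.rpow_nonneg (J.density_pos i).le α)) (by split_ifs <;> norm_num)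
        rw [hR.sum_prob_mul hn i fun P => if OnPath e P then 1 else 0]
        exact hR.sum_pathProb_onPath_le hn i e

/-- Summed over `k`, the active lengths of flow `i` give `d_i - r_i`, which cancels the denominator
in the path probabilities; what remains is linear in the fractional flow. -/
lemma Run.IsValid.expected_dynamic_le (hR : R.IsValid G σ μ α) (hn : 0 < n) (hσ : 0 < σ)
    (hμ : 0 < μ) (hα : 1 < α) (hC : 0 < C) (hD : ∀ i, J.density i ≤ C) :
    ∑ k, J.len k * ∑ e, ∑ P ∈ R.outcomes, R.prob P * rsRate J P e k ^ α
      ≤ (n : ℝ) ^ (α - 1) * (C ^ (α - 1) / min σ μ) *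
        ∑ k, J.len k * fracCost J σ μ α (R.y k) := by
  have hm : 0 < min σ μ := lt_min hσ hμ
  set Y : Fin J.K → Fin n → E → ℝ := fun k i e => R.y k i (e, true) + R.y k i (e, false)
    with hY
  have hY0 : ∀ k i e, 0 ≤ Y k i e := fun k i e =>
    add_nonneg ((hR.1 k).1.nonneg i _) ((hR.1 k).1.nonneg i _)
  calc ∑ k, J.len k * ∑ e, ∑ P ∈ R.outcomes, R.prob P * rsRate J P e k ^ α
      ≤ ∑ k, J.len k * ∑ e, (n : ℝ) ^ (α - 1) * ∑ i, (if J.Active i k then 1 else 0) *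
          (J.density i ^ α * ∑ k', Y k' i e * (J.len k' / (J.d i - J.r i))) :=
        Finset.sum_le_sum fun k _ => mul_le_mul_of_nonneg_left
          (Finset.sum_le_sum fun e _ => hR.expected_rsRate_rpow_le hn hα e k) (J.len_pos hn k).le
    _ = (n : ℝ) ^ (α - 1) * ∑ e, ∑ i, (∑ k, if J.Active i k then J.len k else 0) *
          (J.density i ^ α * ∑ k', Y k' i e * (J.len k' / (J.d i - J.r i))) := by
        -- The inner average does not depend on `k`; hiding it keeps distributivity from expanding
        -- its sum over `k'`.
        generalize hZ : (fun i e => J.density i ^ α *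
          ∑ k', Y k' i e * (J.len k' / (J.d i - J.r i))) = Z
        simp only [funext_iff] at hZ
        simp only [hZ, Finset.mul_sum, Finset.sum_mul]
        rw [Finset.sum_comm]
        refine Finset.sum_congr rfl fun e _ => ?_
        rw [Finset.sum_comm]
        refine Finset.sum_congr rfl fun i _ => Finset.sum_congr rfl fun k _ => ?_
        split_ifs <;> ring
    _ = (n : ℝ) ^ (α - 1) * ∑ k, J.len k * ∑ e, ∑ i, J.density i ^ α * Y k i e := by
        congr 1
        simp only [J.sum_len_active hn]
        have h : ∀ i e, (J.d i - J.r i) * (J.density i ^ α *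
            ∑ k, Y k i e * (J.len k / (J.d i - J.r i)))
            = ∑ k, J.len k * (J.density i ^ α * Y k i e) := by
          intro i e
          have := (sub_pos.2 (J.r_lt_d i)).ne'
          rw [Finset.mul_sum, Finset.mul_sum]
          refine Finset.sum_congr rfl fun k _ => ?_
          field_simp
        have h' : ∑ k, J.len k * ∑ e, ∑ i, J.density i ^ α * Y k i e
            = ∑ e, ∑ i, ∑ k, J.len k * (J.density i ^ α * Y k i e) := by
          simp only [Finset.mul_sum]
          rw [Finset.sum_comm]
          exact Finset.sum_congr rfl fun e _ => Finset.sum_comm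
        rw [h']
        exact Finset.sum_congr rfl fun e _ => Finset.sum_congr rfl fun i _ => h i e
    _ ≤ (n : ℝ) ^ (α - 1) * ∑ k, J.len k *
          ((C ^ (α - 1) / min σ μ) * fracCost J σ μ α (R.y k)) := by
        refine mul_le_mul_of_nonneg_left (Finset.sum_le_sum fun k _ =>
          mul_le_mul_of_nonneg_left ?_ (J.len_pos hn k).le) (by positivity)
        unfold fracCost
        rw [Finset.mul_sum]
        refine Finset.sum_le_sum fun e _ => ?_
        calc ∑ i, J.density i ^ α * Y k i e
            ≤ ∑ i, C ^ (α - 1) * (J.density i * Y k i e) := by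
              refine Finset.sum_le_sum fun i _ => ?_
              have hDi := J.density_pos i
              have : J.density i ^ α = J.density i ^ (α - 1) * J.density i := by
                rw [Real.rpow_sub_one hDi.ne', div_mul_cancel₀ _ hDi.ne']
              rw [this, mul_assoc]
              have := hY0 k i e
              have := hD i
              gcongr
          _ = C ^ (α - 1) / min σ μ * (min σ μ * fracLoad J (R.y k) e) := by
              rw [← Finset.mul_sum, fracLoad, ← mul_assoc, div_mul_cancel₀ _ hm.ne']
          _ ≤ C ^ (α - 1) / min σ μ * power σ μ α (fracLoad J (R.y k) e) := by
              gcongr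
              exact min_mul_le_power hσ hμ hα (fracLoad_nonneg (hR.1 k).1.nonneg e)
    _ = _ := by
        rw [mul_assoc]
        congr 1
        rw [Finset.mul_sum]
        exact Finset.sum_congr rfl fun k _ => by ring

lemma Run.IsValid.expectedEnergy_le_sum (hR : R.IsValid G σ μ α) (hn : 0 < n) (hσ : 0 < σ)
    (hμ : 0 < μ) (hα : 1 < α) (hC : 0 < C) (hD : ∀ i, J.density i ≤ C) :
    R.expectedEnergy σ μ α ≤ (J.lam + μ * ((n : ℝ) ^ (α - 1) * (C ^ (α - 1) / min σ μ))) *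
      ∑ k, J.len k * fracCost J σ μ α (R.y k) := by
  have hT : 0 ≤ J.T1 - J.T0 := by linarith [J.T0_lt_T1 hn]
  have hF : ∀ k, 0 ≤ fracCost J σ μ α (R.y k) := fun k => Finset.sum_nonneg fun e _ =>
    power_nonneg hσ hμ (fracLoad_nonneg (hR.1 k).1.nonneg e)
  set A := (J.T1 - J.T0) * ∑ k, fracCost J σ μ α (R.y k)
  have hA : A ≤ J.lam * ∑ k, J.len k * fracCost J σ μ α (R.y k) := by
    simp only [A, Finset.mul_sum, ← mul_assoc]
    exact Finset.sum_le_sum fun k _ =>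
      mul_le_mul_of_nonneg_right (J.period_le_lam_mul_len hn k) (hF k)
  calc R.expectedEnergy σ μ α
      ≤ ∑ P ∈ R.outcomes, R.prob P * (A + μ * ∑ k, J.len k * ∑ e, rsRate J P e k ^ α) := by
        refine Finset.sum_le_sum fun P hP =>
          mul_le_mul_of_nonneg_left ?_ (hR.prob_nonneg hn P)
        refine (energy_rsSchedule_le hn hμ hα).trans (add_le_add_left ?_ _)
        rw [mul_assoc]
        exact mul_le_mul_of_nonneg_left (hR.mul_card_activeLinks_le hσ hμ hP) hT
    _ = A + μ * ∑ k, J.len k * ∑ e, ∑ P ∈ R.outcomes, R.prob P * rsRate J P e k ^ α := by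
        simp only [mul_add, Finset.sum_add_distrib]
        rw [← Finset.sum_mul, hR.sum_prob hn, one_mul]
        congr 1
        simp only [Finset.mul_sum]
        rw [Finset.sum_comm]
        refine Finset.sum_congr rfl fun k _ => ?_
        rw [Finset.sum_comm]
        exact Finset.sum_congr rfl fun e _ => Finset.sum_congr rfl fun P _ => by ring
    _ ≤ J.lam * (∑ k, J.len k * fracCost J σ μ α (R.y k)) +
          μ * ((n : ℝ) ^ (α - 1) * (C ^ (α - 1) / min σ μ) *
            ∑ k, J.len k * fracCost J σ μ α (R.y k)) := by
        gcongr
        exact hR.expected_dynamic_le hn hσ hμ hα hC hD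
    _ = _ := by ring

/-- The approximation factor, up to `J.ratio α`. -/
noncomputable def approxConst (σ μ α C : ℝ) : ℝ :=
  2 ^ α * (1 + μ * (C ^ (α - 1) / min σ μ))

lemma approxConst_pos (hσ : 0 < σ) (hμ : 0 < μ) (hC : 0 < C) : 0 < approxConst σ μ α C := by
  have hm : 0 < min σ μ := lt_min hσ hμ
  unfold approxConst
  positivity

/-- Only `λ ≥ 1`, `n ≥ 1` and the truncation of the logarithm at 1 are needed. -/
lemma Flows.rpow_le_ratio (J : Flows V n) (hn : 0 < n) (hα : 1 < α) :
    J.lam * (n : ℝ) ^ (α - 1) ≤ J.ratio α ∧ (n : ℝ) ^ (α - 1) * (n : ℝ) ^ (α - 1) ≤ J.ratio α := by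
  have hn1 : (1 : ℝ) ≤ n := by exact_mod_cast hn
  have hl := J.one_le_lam hn
  have hl' : J.lam ≤ J.lam ^ α := Real.self_le_rpow_of_one_le hl hα.le
  have hM : 1 ≤ max 1 (Real.log J.maxDensity) := le_max_left _ _
  have hα' : 0 ≤ α - 1 := by linarith
  have hsq : (n : ℝ) ^ 2 ≤ (n : ℝ) ^ 2 * max 1 (Real.log J.maxDensity) :=
    le_mul_of_one_le_right (by positivity) hM
  have hnsq : (n : ℝ) ≤ (n : ℝ) ^ 2 := by nlinarith
  unfold Flows.ratio
  constructor
  · gcongr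
    exact hnsq.trans hsq
  · rw [← Real.mul_rpow (by positivity) (by positivity), ← sq]
    calc ((n : ℝ) ^ 2) ^ (α - 1) ≤ ((n : ℝ) ^ 2 * max 1 (Real.log J.maxDensity)) ^ (α - 1) := by
          gcongr
      _ ≤ _ := le_mul_of_one_le_left (by positivity) (hl.trans hl')

lemma Run.IsValid.expectedEnergy_le (hR : R.IsValid G σ μ α) (hn : 0 < n) (hσ : 0 < σ)
    (hμ : 0 < μ) (hα : 1 < α) (hC : 0 < C) {S : Schedule E n} (hS : S.Feasible G J C) :
    R.expectedEnergy σ μ α ≤ approxConst σ μ α C * J.ratio α * S.energy J σ μ α := by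
  have hm : 0 < min σ μ := lt_min hσ hμ
  have hl := J.one_le_lam hn
  have hE := (hS.energy_pos hn hσ hμ hα).le
  obtain ⟨h1, h2⟩ := J.rpow_le_ratio hn hα
  calc R.expectedEnergy σ μ α
      ≤ (J.lam + μ * ((n : ℝ) ^ (α - 1) * (C ^ (α - 1) / min σ μ))) *
          ∑ k, J.len k * fracCost J σ μ α (R.y k) :=
        hR.expectedEnergy_le_sum hn hσ hμ hα hC hS.density_le
    _ ≤ (J.lam + μ * ((n : ℝ) ^ (α - 1) * (C ^ (α - 1) / min σ μ))) *
          (2 ^ α * (n : ℝ) ^ (α - 1) * S.energy J σ μ α) := by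
        gcongr
        exact hS.sum_len_mul_fracCost_le hn hσ hμ hα hR.1
    _ = 2 ^ α * (J.lam * (n : ℝ) ^ (α - 1) + μ * (C ^ (α - 1) / min σ μ) *
          ((n : ℝ) ^ (α - 1) * (n : ℝ) ^ (α - 1))) * S.energy J σ μ α := by ring
    _ ≤ 2 ^ α * (J.ratio α + μ * (C ^ (α - 1) / min σ μ) * J.ratio α) * S.energy J σ μ α := by
        gcongr
    _ = _ := by
        rw [approxConst]
        ring

/-- Markov's inequality. -/
lemma Run.IsValid.probEnergyGt_le (hR : R.IsValid G σ μ α) (hn : 0 < n) (hσ : 0 < σ)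
    (hμ : 0 < μ) {a b : ℝ} (ha : 0 < a) (hb : 0 < b)
    (h : R.expectedEnergy σ μ α ≤ b) : R.probEnergyGt σ μ α (a * b) ≤ 1 / a := by
  have hT : 0 ≤ J.T1 - J.T0 := by linarith [J.T0_lt_T1 hn]
  have hE : ∀ P, 0 ≤ (rsSchedule J P : Schedule E n).energy J σ μ α := by
    intro P
    unfold Schedule.energy
    refine add_nonneg (by positivity) (intervalIntegral.integral_nonneg (by linarith) fun t _ =>
      Finset.sum_nonneg fun e _ => mul_nonneg hμ.le (Real.rpow_nonneg
        (linkRate_nonneg (fun _ _ _ => rsSchedule_rate_nonneg _) e t) α))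
  have h1 : a * b * R.probEnergyGt σ μ α (a * b) ≤ b := by
    refine le_trans ?_ h
    unfold Run.probEnergyGt Run.expectedEnergy
    rw [Finset.mul_sum]
    refine le_trans (Finset.sum_le_sum fun P hP => ?_) (Finset.sum_le_sum_of_subset_of_nonneg
      (Finset.filter_subset _ _) fun P _ _ => mul_nonneg (hR.prob_nonneg hn P) (hE P))
    rw [mul_comm]
    exact mul_le_mul_of_nonneg_left (Finset.mem_filter.1 hP).2.le (hR.prob_nonneg hn P)
  rw [le_div_iff₀ ha]
  refine le_of_mul_le_mul_left ?_ hb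
  linarith

end UpperBound

end DCFSR

/-- Bounds against every feasible `S` pass to the infimum `Φ_opt`: for the tail, finitely many
outcomes exist, so those exceeding the limit threshold also exceed the threshold of some nearly
optimal `S`. -/
theorem mainTheorem5 (σ μ α C : ℝ) (hσ : 0 < σ) (hμ : 0 < μ) (hα : 1 < α) (hC : 0 < C) :
    ∃ c : ℝ, 0 < c ∧
      ∀ (V E : Type*) [Fintype V] [Fintype E] (G : DCFSR.Network V E)
        (n : ℕ) (_ : 0 < n) (J : DCFSR.Flows V n),
        (∃ S : DCFSR.Schedule E n, S.Feasible G J C) →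
        (∃ R : DCFSR.Run V E J, R.IsValid G σ μ α) ∧
        ∀ R : DCFSR.Run V E J, R.IsValid G σ μ α →
          ((∀ i, ∀ P ∈ R.candidates i, 0 ≤ R.pathProb i P) ∧
            ∀ i, ∑ P ∈ R.candidates i, R.pathProb i P = 1) ∧
          (∀ P ∈ R.outcomes, (DCFSR.rsSchedule J P).MeetsDeadlines G J) ∧
          ∀ S : DCFSR.Schedule E n, S.Feasible G J C →
            R.expectedEnergy σ μ α ≤ c * J.ratio α * S.energy J σ μ α ∧
            ∀ a : ℝ, 0 < a →
              R.probEnergyGt σ μ α (a * (c * J.ratio α * S.energy J σ μ α)) ≤ 1 / a := by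

  refine ⟨DCFSR.approxConst σ μ α C, DCFSR.approxConst_pos hσ hμ hC, ?_⟩
  intro V E _ _ G n hn J ⟨S₀, hS₀⟩
  refine ⟨DCFSR.exists_isValid hσ hμ hα hS₀.1.isPath, fun R hR => ?_⟩
  refine ⟨⟨fun i P _ => hR.pathProb_nonneg hn i P, hR.sum_pathProb hn⟩, fun P hP => ?_,
    fun S hS => ?_⟩
  · exact DCFSR.rsSchedule_meetsDeadlines hn fun i =>
      hR.isPath (Fintype.mem_piFinset.1 hP i)
  · have h := hR.expectedEnergy_le hn hσ hμ hα hC hS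
    have hratio : 0 < J.ratio α := by
      have h1 : (0 : ℝ) < n := by exact_mod_cast hn
      refine lt_of_lt_of_le ?_ (J.rpow_le_ratio hn hα).2
      positivity
    exact ⟨h, fun a ha => hR.probEnergyGt_le hn hσ hμ ha
      (mul_pos (mul_pos (DCFSR.approxConst_pos hσ hμ hC) hratio)
        (hS.energy_pos hn hσ hμ hα)) h⟩
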